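/- There are $B$ bidders and one item is for sale in each of $T$ rounds. In every round bidder $\ell$ draws a value, independently of everything else, from a distribution $\mathcal D_\ell$ supported on finitely many values $0\le v_{\ell,1}<\dots<v_{\ell,m_\ell}\le 1$ with probabilities $q_{\ell,i}>0$; put $q_{\min}=\min_{\ell,i}q_{\ell,i}$. Every bidder has the bid options $b_0=0$ (the zero option) and $b_1,\dots,b_K\in[0,1]$. In each round the auctioneer fixes an allocation rule $a$ and a price rule $p$, which map the profile of chosen options to winning probabilities $a_\ell\ge 0$ with $\sum_\ell a_\ell\le 1$ and to prices $p_\ell$ with $0\le p_\ell\le a_\ell b_{k_\ell}$, where $k_\ell$ is the option chosen by bidder $\ell$, and $a_\ell=0$ if $k_\ell=0$. The auctioneer is adaptive: the rules of a round may depend on everything that happened in all previous rounds (values, pulled arms, bids), but not on the values and choices of the current round. The utility of bidder $\ell$ with value $v$ in a round is $v a_\ell-p_\ell$. A bandit algorithm assigns to each history of pulled arms and observed rewards a probability distribution over arms. It is $\delta$-no-regret over $T$ rounds if, for every adversary that chooses the reward vector $(r_{a,t})_a$ of round $t$, with entries in $[-1,1]$, as a function of the previously pulled arms $I_1,\dots,I_{t-1}$,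 one has $\mathbb E[\max_a\sum_{t=1}^T r_{a,t}-\sum_{t=1}^T r_{I_t,t}]\le\delta$. Bidder $\ell$ plays as follows. The bidder takes a $\delta$-no-regret bandit algorithm that always gives every arm positive probability, and runs $m_\ell$ copies $M_{\ell,1},\dots,M_{\ell,m_\ell}$ of it; the arms of each copy are the bid options and one "value arm" for each of the $m_\ell$ values. In a round with value $v_{\ell,i}$, an arm is drawn from $M_{\ell,i}$. If it is a bid option, that option is chosen. If it is the value arm of $v_{\ell,j}$, a fresh arm is sampled from the current distribution of $M_{\ell,j}$ (without updating $M_{\ell,j}$), and one continues in the same way until a bid option is reached. At the end of the round only $M_{\ell,i}$ is updated, with the arm that it pulled and the utility of the round. A single-round direct mechanism maps profiles of reported values to winning probabilities with sum at most $1$ and to expected payments. It is $\varepsilon$-BIC if no bidder can gain more than $\varepsilon$ in expected utility by misreporting when the others report truthfully, and $\varepsilon$-IR if the interim expected utility of truthful reporting is at least $-\varepsilon$. Let $\mathsf{Mye}(\mathcal D_1,\dots,\mathcal D_B)$ be the supremum of the expected revenues of the $0$-BIC, $0$-IR mechanisms when values are drawn independently from $\mathcal D_1,\dots,\mathcal D_B$.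 **Theorem.** For every $B$ there is a constant $C$ (depending on $B$ only) such that, if every bidder plays as described, then for every adaptive auctioneer the expected revenue over the $T$ rounds is at most $$\mathsf{Mye}(\mathcal D_1,\dots,\mathcal D_B)\,T+C\sqrt{\frac{\delta T}{q_{\min}}}.$$ Moreover, the time-averaged mechanism, which to reported values $w$ assigns the averages over $t=1,\dots,T$ of the expected allocations and prices of round $t$ given that the values of round $t$ are $w$, is a valid single-round mechanism, and it is $\varepsilon$-BIC and $\varepsilon$-IR with $\varepsilon=\delta/(q_{\min}T)$. -/

import Mathlib

open scoped BigOperators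

noncomputable section

namespace NoRegretAuction

/-! ### Value distributions and single-round mechanisms -/

/-- A distribution on finitely many values `0 ≤ val 0 < val 1 < ... ≤ 1`, each of positive
probability. -/
structure ValueDist where
  m : ℕ
  val : Fin m → ℝ
  prob : Fin m → ℝ
  val_strictMono : StrictMono val
  val_nonneg : ∀ i, 0 ≤ val i
  val_le_one : ∀ i, val i ≤ 1
  prob_pos : ∀ i, 0 < prob i
  prob_sum : ∑ i, prob i = 1

/-- A profile of values (given by their indices), one for each bidder. -/
abbrev Profile {B : ℕ} (D : Fin B → ValueDist) : Type :=
  (l : Fin B) → Fin (D l).m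

/-- Probability of a profile when the values are drawn independently. -/
def profileProb {B : ℕ} (D : Fin B → ValueDist) (w : Profile D) : ℝ :=
  ∏ l, (D l).prob (w l)

/-- The smallest probability of a value, over all bidders and all values. -/
def qMin {B : ℕ} (D : Fin B → ValueDist) : ℝ :=
  ⨅ x : (l : Fin B) × Fin (D l).m, (D x.1).prob x.2

/-- A single-round direct mechanism: winning probabilities and (expected) payments as functions
of the reported values. -/
structure DirectMechanism {B : ℕ} (D : Fin B → ValueDist) where
  alloc : Profile D → Fin B → ℝ
  pay : Profile D → Fin B → ℝ

namespace DirectMechanism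

variable {B : ℕ} {D : Fin B → ValueDist}

/-- There is only one item to allocate. -/
def IsFeasible (X : DirectMechanism D) : Prop :=
  (∀ w l, 0 ≤ X.alloc w l) ∧ ∀ w, ∑ l, X.alloc w l ≤ 1

/-- Expected utility of bidder `l` who has the value with index `i` and reports the one with
index `j`, when all the other bidders report truthfully. -/
def interimUtility (X : DirectMechanism D) (l : Fin B) (i j : Fin (D l).m) : ℝ :=
  ∑ w : Profile D, profileProb D w *
    ((D l).val i * X.alloc (Function.update w l j) l - X.pay (Function.update w l j) l)

/-- `ε`-Bayesian incentive compatibility: a misreport gains at most `ε`. -/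
def IsBIC (X : DirectMechanism D) (ε : ℝ) : Prop :=
  ∀ (l : Fin B) (i j : Fin (D l).m), X.interimUtility l i j ≤ X.interimUtility l i i + ε

/-- `ε`-ex-interim individual rationality. -/
def IsInterimIR (X : DirectMechanism D) (ε : ℝ) : Prop :=
  ∀ (l : Fin B) (i : Fin (D l).m), -ε ≤ X.interimUtility l i i

/-- Expected revenue under truthful reports. -/
def revenue (X : DirectMechanism D) : ℝ :=
  ∑ w : Profile D, profileProb D w * ∑ l, X.pay w l

end DirectMechanism

/-- The optimal single-round revenue from selling one item to bidders with independent values: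
the supremum over all Bayesian incentive compatible, ex-interim individually rational
mechanisms. -/
def mye {B : ℕ} (D : Fin B → ValueDist) : ℝ :=
  sSup {R : ℝ | ∃ X : DirectMechanism D,
    X.IsFeasible ∧ X.IsBIC 0 ∧ X.IsInterimIR 0 ∧ X.revenue = R}

/-! ### Bandit algorithms

All histories are lists with the most recent round first. -/

/-- A randomized bandit algorithm: a distribution over arms for each history of pulled arms and
observed rewards. -/
structure BanditAlg (A : Type) [Fintype A] where
  prob : List (A × ℝ) → A → ℝ
  prob_nonneg : ∀ h a, 0 ≤ prob h a
  prob_sum : ∀ h, ∑ a, prob h a = 1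

namespace BanditAlg

variable {A : Type} [Fintype A]

/-- Every arm always has a positive probability. -/
def HasFullSupport (M : BanditAlg A) : Prop :=
  ∀ h a, 0 < M.prob h a

/-- What the algorithm has observed after pulling the arms `h`, when `adv h' a` is the reward of
arm `a` in the round that follows the pulls `h'`. -/
def feedback (adv : List A → A → ℝ) : List A → List (A × ℝ)
  | [] => []
  | a :: h => (a, adv h a) :: feedback adv h

/-- Total reward of always pulling arm `j`, along the realized rewards. -/
def armTotal (adv : List A → A → ℝ) (j : A) : List A → ℝ
  | [] => 0
  | _ :: h => adv h j + armTotal adv j h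

/-- Total reward collected. -/
def earned (adv : List A → A → ℝ) : List A → ℝ
  | [] => 0
  | a :: h => adv h a + earned adv h

/-- The regret, a random variable through the pulled arms `h`. -/
def regret (adv : List A → A → ℝ) (h : List A) : ℝ :=
  (⨆ j, armTotal adv j h) - earned adv h

/-- Expectation of `F` of the final list of pulled arms, after `n` further rounds from `h`. -/
def expect (M : BanditAlg A) (adv : List A → A → ℝ) (F : List A → ℝ) : ℕ → List A → ℝ
  | 0, h => F h
  | n + 1, h => ∑ a, M.prob (feedback adv h) a * expect M adv F n (a :: h)

/-- `M` is `δ`-no-regret over `T` rounds: the expected regret is at most `δ` whatever the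
adversary, who may choose the reward vector of each round (with entries in `[-1, 1]`, the range of
the utilities of a bidder) depending on all previous pulls. -/
def IsNoRegret (M : BanditAlg A) (T : ℕ) (δ : ℝ) : Prop :=
  ∀ adv : List A → A → ℝ, (∀ h a, adv h a ∈ Set.Icc (-1 : ℝ) 1) →
    M.expect adv (regret adv) T [] ≤ δ

end BanditAlg

/-! ### The repeated auction -/

/-- The arms of an instance: the bid arms (the bid options `0, ..., K`, where option `0` is the
zero option) and one value arm for each of the `m` values. -/
abbrev Arm (K m : ℕ) : Type := Fin (K + 1) ⊕ Fin m

/-- The allocation and pricing rules of one round, as functions of the profile of chosen bid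
options, where option `k` is the bid `b k`. -/
structure AuctionRule (B K : ℕ) (b : Fin (K + 1) → ℝ) where
  alloc : (Fin B → Fin (K + 1)) → Fin B → ℝ
  price : (Fin B → Fin (K + 1)) → Fin B → ℝ
  alloc_nonneg : ∀ β l, 0 ≤ alloc β l
  alloc_sum_le : ∀ β, ∑ l, alloc β l ≤ 1
  price_nonneg : ∀ β l, 0 ≤ price β l
  price_le : ∀ β l, price β l ≤ alloc β l * b (β l)
  alloc_zero : ∀ β l, β l = 0 → alloc β l = 0

/-- What happens in one round: for each bidder the index of the value, the arm pulled by the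
corresponding instance, and the bid option that is finally chosen. -/
abbrev Round {B : ℕ} (K : ℕ) (D : Fin B → ValueDist) : Type :=
  (l : Fin B) → Fin (D l).m × Arm K (D l).m × Fin (K + 1)

variable {B K : ℕ} {D : Fin B → ValueDist} {b : Fin (K + 1) → ℝ}

/-- The chosen bid options of a round. -/
def bidsOf (r : Round K D) : Fin B → Fin (K + 1) := fun l => (r l).2.2

/-- An adaptive auctioneer chooses the rules of each round knowing everything that happened in
all previous rounds. -/
abbrev Auctioneer {B : ℕ} (K : ℕ) (D : Fin B → ValueDist) (b : Fin (K + 1) → ℝ) : Type :=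
  List (Round K D) → AuctionRule B K b

/-- `P j` is the distribution over arms of the instance for the value with index `j`.
`resolveWithin P n a k` is the probability that arm `a` leads to the bid option `k` after at most
`n` recursive samples: a bid arm is final, and at the value arm `j` a fresh arm is sampled
from `P j`. -/
def resolveWithin {K m : ℕ} (P : Fin m → Arm K m → ℝ) :
    ℕ → Arm K m → Fin (K + 1) → ℝ
  | _, Sum.inl k', k => if k' = k then 1 else 0
  | 0, Sum.inr _, _ => 0
  | n + 1, Sum.inr j, k => ∑ a, P j a * resolveWithin P n a k

/-- The probability that arm `a` finally leads to the bid option `k`, the (monotone) limit of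
`resolveWithin`. -/
def resolve {K m : ℕ} (P : Fin m → Arm K m → ℝ) (a : Arm K m) (k : Fin (K + 1)) : ℝ :=
  ⨆ n, resolveWithin P n a k

/-- Utility of bidder `l` in a round. -/
def roundUtility (R : AuctionRule B K b) (r : Round K D) (l : Fin B) : ℝ :=
  (D l).val (r l).1 * R.alloc (bidsOf r) l - R.price (bidsOf r) l

/-- The observations of the instance of bidder `l` for the value with index `i`: that instance
is updated exactly in the rounds in which the bidder has this value, with the arm that it pulled
and the utility of the round. -/
def instanceHistory (S : Auctioneer K D b) (l : Fin B) (i : Fin (D l).m) :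
    List (Round K D) → List (Arm K (D l).m × ℝ)
  | [] => []
  | r :: h =>
    if (r l).1 = i then ((r l).2.1, roundUtility (S h) r l) :: instanceHistory S l i h
    else instanceHistory S l i h

/-- The distribution over arms of the instance of bidder `l` for the value with index `i`, in the
round after the history `h`, when bidder `l` uses the bandit algorithm `M l`. -/
def instanceProb (M : (l : Fin B) → BanditAlg (Arm K (D l).m)) (S : Auctioneer K D b)
    (h : List (Round K D)) (l : Fin B) (i : Fin (D l).m) : Arm K (D l).m → ℝ :=
  (M l).prob (instanceHistory S l i h)

/-- The probability of `r` in the round after the history `h`: independently for all bidders, a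
value is drawn, the instance for this value pulls an arm, and the arm leads to a bid option. -/
def roundProb (M : (l : Fin B) → BanditAlg (Arm K (D l).m)) (S : Auctioneer K D b)
    (h : List (Round K D)) (r : Round K D) : ℝ :=
  ∏ l, ((D l).prob (r l).1 * instanceProb M S h l (r l).1 (r l).2.1 *
    resolve (instanceProb M S h l) (r l).2.1 (r l).2.2)

/-- Expectation of `F` of the history after `n` further rounds from `h`. -/
def historyExpect (M : (l : Fin B) → BanditAlg (Arm K (D l).m)) (S : Auctioneer K D b)
    (F : List (Round K D) → ℝ) : ℕ → List (Round K D) → ℝ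
  | 0, h => F h
  | n + 1, h => ∑ r, roundProb M S h r * historyExpect M S F n (r :: h)

/-- The total amount paid to the auctioneer along a history. -/
def totalPayments (S : Auctioneer K D b) : List (Round K D) → ℝ
  | [] => 0
  | r :: h => (∑ l, (S h).price (bidsOf r) l) + totalPayments S h

/-- The expected revenue of the auctioneer over `T` rounds. -/
def expectedRevenue (M : (l : Fin B) → BanditAlg (Arm K (D l).m)) (S : Auctioneer K D b)
    (T : ℕ) : ℝ :=
  historyExpect M S (totalPayments S) T []

/-- The values of a round. -/
def valuesOf (r : Round K D) : Profile D := fun l => (r l).1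

/-- The conditional expectation of `f` (a function of the past and of the round) in the round
after `t` rounds, given that the values of that round are `w`. -/
def condRoundExpect (M : (l : Fin B) → BanditAlg (Arm K (D l).m)) (S : Auctioneer K D b)
    (f : List (Round K D) → Round K D → ℝ) (t : ℕ) (w : Profile D) : ℝ :=
  historyExpect M S (fun h => ∑ r, roundProb M S h r * if valuesOf r = w then f h r else 0) t [] /
    profileProb D w

/-- The time-averaged mechanism: sample a round uniformly among the `T` rounds, and use the
expected allocation and prices of that round given that its values are the reported ones. -/
def timeAveraged (M : (l : Fin B) → BanditAlg (Arm K (D l).m)) (S : Auctioneer K D b)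
    (T : ℕ) : DirectMechanism D where
  alloc w l := (∑ t ∈ Finset.range T,
    condRoundExpect M S (fun h r => (S h).alloc (bidsOf r) l) t w) / T
  pay w l := (∑ t ∈ Finset.range T,
    condRoundExpect M S (fun h r => (S h).price (bidsOf r) l) t w) / T

end NoRegretAuction

end

open NoRegretAuction

open NoRegretAuction

/-! ### Finite product distributions -/

namespace FiniteProduct

open Finset

variable {ι : Type*} [Fintype ι] [DecidableEq ι] {α : ι → Type*}

/-! Value arms turn regret into incentive constraints. Pulling the value arm of `j` yields a bid
option with the same distribution as the bid made at value `j` (`resolve_inr`). So the expected gain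
of that arm over actual play, in the rounds with value `i`, is `prob i * T` times the gain from
reporting `j` instead of `i` in the time-averaged mechanism (`cumExpect_armGain_inr`). The zero bid
earns nothing, so regret against it controls the truthful utility (`cumExpect_armGain_zero`). Regret
at most `δ` then gives both `ε`-BIC and `ε`-IR. One obstacle is that the guarantee concerns
adversaries that see only the pulled arms, while the rewards of an instance also depend on other
bidders, other instances and the random resolution of value arms. `exists_strategy` removes this
extra randomness by averaging.

For the revenue, an `ε`-BIC and `ε`-IR mechanism is converted into an exact one at a loss that does
not depend on the number of values. Each bidder's report is resampled through an assortative
coupling of the value distribution with itself. This preserves the distribution of reports, so the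
other bidders face an unchanged interim problem (`resampled_interimAlloc`). It makes the interim
allocation monotone without lowering the bidder's contribution to welfare. Exact incentive
compatibility then costs the information rent of the new allocation. That allocation lies below the
running maximum of the old one (`assortative_mean_le`), and approximate incentive compatibility
already grants almost the full rent of this running maximum (`rent_partialSups_le`). The loss per
bidder is `η + 4 * ε / η + 3 * ε`, and `η = √ε` makes it of order `√ε`. -/

lemma prod_update_mul (p : ∀ i, α i → ℝ) (r : ∀ i, α i) (l : ι) (x : α l) :
    (∏ i, p i (Function.update r l x i)) * p l (r l) = (∏ i, p i (r i)) * p l x := by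
  rw [← mul_prod_erase univ _ (mem_univ l),
    ← mul_prod_erase univ (fun i => p i (r i)) (mem_univ l)]
  have : ∏ i ∈ univ.erase l, p i (Function.update r l x i) = ∏ i ∈ univ.erase l, p i (r i) :=
    prod_congr rfl fun i hi => by rw [Function.update_of_ne (ne_of_mem_erase hi)]
  rw [this, Function.update_self]
  ring

variable [∀ i, Fintype (α i)]

lemma sum_prod_eq_one (p : ∀ i, α i → ℝ) (hp : ∀ i, ∑ x, p i x = 1) :
    ∑ r : ∀ i, α i, ∏ i, p i (r i) = 1 := by
  rw [← Fintype.prod_sum]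
  simp [hp]

/-- Resampling one coordinate does not change expectations under a product distribution. -/
lemma sum_resample (p : ∀ i, α i → ℝ) (l : ι) (hp : ∑ x, p l x = 1) (F : (∀ i, α i) → ℝ) :
    ∑ r : ∀ i, α i, (∏ i, p i (r i)) * F r =
      ∑ r : ∀ i, α i, (∏ i, p i (r i)) * ∑ x, p l x * F (Function.update r l x) := by
  -- Swapping coordinate `l` with an independent fresh sample is an involution that preserves the
  -- joint weight.
  have hinv : Function.Involutive
      (fun z : (∀ i, α i) × α l => (Function.update z.1 l z.2, z.1 l)) := by
    rintro ⟨r, x⟩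
    simp
  have key := Equiv.sum_comp hinv.toPerm
    (fun z : (∀ i, α i) × α l => (∏ i, p i (z.1 i)) * p l z.2 * F z.1)
  calc ∑ r : ∀ i, α i, (∏ i, p i (r i)) * F r
      = ∑ z : (∀ i, α i) × α l, (∏ i, p i (z.1 i)) * p l z.2 * F z.1 := by
        rw [Fintype.sum_prod_type]
        refine sum_congr rfl fun r _ => ?_
        simp only [← sum_mul, ← mul_sum, hp, mul_one]
    _ = _ := by
        rw [← key, Fintype.sum_prod_type]
        refine sum_congr rfl fun r _ => ?_
        rw [mul_sum]
        refine sum_congr rfl fun x _ => ?_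
        simp only [Function.Involutive.coe_toPerm]
        rw [prod_update_mul]
        ring

end FiniteProduct

/-- The derandomization tool: a random choice can be replaced by a fixed one without lowering the
expected value. -/
lemma exists_weighted_sum_le {α : Type*} [Fintype α] (p : α → ℝ) (hp : ∀ x, 0 ≤ p x)
    (hs : ∑ x, p x = 1) (F : α → ℝ) : ∃ x, ∑ y, p y * F y ≤ F x := by
  by_contra! hlt
  set e := ∑ y, p y * F y with he
  have h1 : ∑ y, p y * (e - F y) = 0 := by
    simp only [mul_sub, Finset.sum_sub_distrib, ← Finset.sum_mul, hs, one_mul, ← he, sub_self]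
  have h2 := (Finset.sum_eq_zero_iff_of_nonneg
    (fun y _ => mul_nonneg (hp y) (sub_nonneg.2 (hlt y).le))).1 h1
  have h3 : ∑ x, p x = 0 := Finset.sum_eq_zero fun y hy => by
    rcases mul_eq_zero.1 (h2 y hy) with h | h
    · exact h
    · linarith [hlt y]
  linarith

lemma weighted_sum_const {α : Type*} [Fintype α] (p : α → ℝ) (hs : ∑ x, p x = 1) (c : ℝ) :
    ∑ x, p x * c = c := by
  rw [← Finset.sum_mul, hs, one_mul]

namespace NoRegretAuction

/-! ### Resolution of value arms -/

section Resolve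

variable {K m : ℕ} {P : Fin m → Arm K m → ℝ}

lemma resolveWithin_inl (P : Fin m → Arm K m → ℝ) (n : ℕ) (k' k : Fin (K + 1)) :
    resolveWithin P n (Sum.inl k') k = if k' = k then 1 else 0 := by
  cases n <;> rfl

lemma resolveWithin_nonneg (hP : ∀ j a, 0 ≤ P j a) (n : ℕ) (a : Arm K m) (k : Fin (K + 1)) :
    0 ≤ resolveWithin P n a k := by
  induction n generalizing a with
  | zero => rcases a with k' | j <;> simp only [resolveWithin] <;> positivity
  | succ n ih =>
    rcases a with k' | j
    · rw [resolveWithin_inl]; split_ifs <;> norm_num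
    · exact Finset.sum_nonneg fun a _ => mul_nonneg (hP j a) (ih a)

lemma resolveWithin_le_succ (hP : ∀ j a, 0 ≤ P j a) (n : ℕ) (a : Arm K m) (k : Fin (K + 1)) :
    resolveWithin P n a k ≤ resolveWithin P (n + 1) a k := by
  induction n generalizing a with
  | zero =>
    rcases a with k' | j
    · simp only [resolveWithin_inl]; exact le_rfl
    · exact resolveWithin_nonneg hP 1 _ _
  | succ n ih =>
    rcases a with k' | j
    · simp only [resolveWithin_inl]; exact le_rfl
    · exact Finset.sum_le_sum fun a _ => mul_le_mul_of_nonneg_left (ih a) (hP j a)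

lemma sum_resolveWithin_inr (P : Fin m → Arm K m → ℝ) (n : ℕ) (j : Fin m) :
    ∑ k, resolveWithin P (n + 1) (Sum.inr j) k = ∑ a, P j a * ∑ k, resolveWithin P n a k := by
  simp only [resolveWithin, Finset.mul_sum]
  exact Finset.sum_comm

lemma sum_resolveWithin_inl (P : Fin m → Arm K m → ℝ) (n : ℕ) (k' : Fin (K + 1)) :
    ∑ k, resolveWithin P n (Sum.inl k') k = 1 := by
  simp [resolveWithin_inl]

lemma sum_resolveWithin_le_one (hP : ∀ j a, 0 ≤ P j a) (hs : ∀ j, ∑ a, P j a = 1) (n : ℕ)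
    (a : Arm K m) : ∑ k, resolveWithin P n a k ≤ 1 := by
  induction n generalizing a with
  | zero =>
    rcases a with k' | j
    · exact (sum_resolveWithin_inl P 0 k').le
    · simp [resolveWithin]
  | succ n ih =>
    rcases a with k' | j
    · exact (sum_resolveWithin_inl P _ k').le
    · rw [sum_resolveWithin_inr]
      calc ∑ a, P j a * ∑ k, resolveWithin P n a k ≤ ∑ a, P j a * 1 :=
            Finset.sum_le_sum fun a _ => mul_le_mul_of_nonneg_left (ih a) (hP j a)
        _ = 1 := by simp [hs]

/-- Every fresh sample stops at the zero bid with probability at least `c`, so the mass still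
unresolved after `n` samples decays like `(1 - c) ^ n`. -/
lemma le_sum_resolveWithin (hP : ∀ j a, 0 ≤ P j a) (hs : ∀ j, ∑ a, P j a = 1) {c : ℝ}
    (hc1 : c ≤ 1) (hc : ∀ j, c ≤ P j (Sum.inl 0)) (n : ℕ) (a : Arm K m) :
    1 - (1 - c) ^ n ≤ ∑ k, resolveWithin P n a k := by
  have hpow : ∀ n : ℕ, 0 ≤ (1 - c) ^ n := fun n => pow_nonneg (by linarith) n
  induction n generalizing a with
  | zero =>
    simp only [pow_zero, sub_self]
    exact Finset.sum_nonneg fun k _ => resolveWithin_nonneg hP _ _ _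
  | succ n ih =>
    rcases a with k' | j
    · rw [sum_resolveWithin_inl]
      linarith [hpow (n + 1)]
    · rw [sum_resolveWithin_inr]
      have h1 := Finset.single_le_sum
        (f := fun a => P j a * (∑ k, resolveWithin P n a k - (1 - (1 - c) ^ n)))
        (fun a _ => mul_nonneg (hP j a) (sub_nonneg.2 (ih a))) (Finset.mem_univ (Sum.inl 0))
      simp only [mul_sub (P j _) (Finset.sum _ _), Finset.sum_sub_distrib,
        weighted_sum_const _ (hs j), sum_resolveWithin_inl] at h1
      have h2 := mul_le_mul_of_nonneg_right (hc j) (hpow n)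
      rw [pow_succ]
      linarith

lemma bddAbove_resolveWithin (hP : ∀ j a, 0 ≤ P j a) (hs : ∀ j, ∑ a, P j a = 1)
    (a : Arm K m) (k : Fin (K + 1)) : BddAbove (Set.range fun n => resolveWithin P n a k) := by
  refine ⟨1, ?_⟩
  rintro _ ⟨n, rfl⟩
  exact (Finset.single_le_sum (fun k _ => resolveWithin_nonneg hP n a k)
    (Finset.mem_univ k)).trans (sum_resolveWithin_le_one hP hs n a)

lemma tendsto_resolveWithin (hP : ∀ j a, 0 ≤ P j a) (hs : ∀ j, ∑ a, P j a = 1)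
    (a : Arm K m) (k : Fin (K + 1)) :
    Filter.Tendsto (fun n => resolveWithin P n a k) Filter.atTop (nhds (resolve P a k)) :=
  tendsto_atTop_ciSup (monotone_nat_of_le_succ fun n => resolveWithin_le_succ hP n a k)
    (bddAbove_resolveWithin hP hs a k)

lemma resolve_nonneg (hP : ∀ j a, 0 ≤ P j a) (a : Arm K m) (k : Fin (K + 1)) :
    0 ≤ resolve P a k :=
  Real.iSup_nonneg fun n => resolveWithin_nonneg hP n a k

lemma resolve_inl (P : Fin m → Arm K m → ℝ) (k' k : Fin (K + 1)) :
    resolve P (Sum.inl k') k = if k' = k then 1 else 0 := by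
  simp [resolve, resolveWithin_inl]

/-- The recursion passes to the limit. The right side is the law of the option chosen by a bidder
whose value has index `j`, so this value arm imitates that bidder. -/
lemma resolve_inr (hP : ∀ j a, 0 ≤ P j a) (hs : ∀ j, ∑ a, P j a = 1) (j : Fin m)
    (k : Fin (K + 1)) : resolve P (Sum.inr j) k = ∑ a, P j a * resolve P a k :=
  tendsto_nhds_unique
    ((Filter.tendsto_add_atTop_iff_nat 1).2 (tendsto_resolveWithin hP hs (Sum.inr j) k))
    (tendsto_finsetSum _ fun a _ => (tendsto_resolveWithin hP hs a k).const_mul (P j a))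

/-- When every bid arm has a positive probability, a bid option is reached almost surely. -/
lemma sum_resolve (hP : ∀ j a, 0 < P j a) (hs : ∀ j, ∑ a, P j a = 1) (a : Arm K m) :
    ∑ k, resolve P a k = 1 := by
  have hP' : ∀ j a, 0 ≤ P j a := fun j a => (hP j a).le
  obtain ⟨c, hc0, hc1, hc⟩ : ∃ c : ℝ, 0 < c ∧ c ≤ 1 ∧ ∀ j, c ≤ P j (Sum.inl 0) := by
    -- A uniform stopping rate exists because there are finitely many instances; with none of them,
    -- any `c` in `(0, 1]` will do.
    rcases isEmpty_or_nonempty (Fin m) with hm | hm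
    · exact ⟨1, one_pos, le_rfl, fun j => hm.elim j⟩
    · obtain ⟨j0, hj0⟩ := Finite.exists_min fun j => P j (Sum.inl 0)
      refine ⟨P j0 (Sum.inl 0), hP _ _, ?_, hj0⟩
      rw [← hs j0]
      exact Finset.single_le_sum (fun a _ => hP' j0 a) (Finset.mem_univ _)
  have h1 : Filter.Tendsto (fun n => ∑ k, resolveWithin P n a k) Filter.atTop
      (nhds (∑ k, resolve P a k)) :=
    tendsto_finsetSum _ fun k _ => tendsto_resolveWithin hP' hs a k
  have h2 : Filter.Tendsto (fun n : ℕ => 1 - (1 - c) ^ n) Filter.atTop (nhds (1 - 0)) :=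
    (tendsto_pow_atTop_nhds_zero_of_lt_one (by linarith) (by linarith)).const_sub 1
  rw [sub_zero] at h2
  exact le_antisymm (le_of_tendsto' h1 fun n => sum_resolveWithin_le_one hP' hs n a)
    (le_of_tendsto_of_tendsto' h2 h1 fun n => le_sum_resolveWithin hP' hs hc1 hc n a)

end Resolve

/-! ### The process of rounds -/

section Rounds

variable {B K : ℕ} {D : Fin B → ValueDist} {b : Fin (K + 1) → ℝ}
  {M : (l : Fin B) → BanditAlg (Arm K (D l).m)} {S : Auctioneer K D b}

lemma instanceProb_pos (hM : ∀ l, (M l).HasFullSupport) (S : Auctioneer K D b)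
    (h : List (Round K D)) (l : Fin B) (i : Fin (D l).m) (a : Arm K (D l).m) :
    0 < instanceProb M S h l i a := hM l _ a

lemma sum_instanceProb (M : (l : Fin B) → BanditAlg (Arm K (D l).m)) (S : Auctioneer K D b)
    (h : List (Round K D)) (l : Fin B) (i : Fin (D l).m) :
    ∑ a, instanceProb M S h l i a = 1 := (M l).prob_sum _

lemma resolve_instanceProb_nonneg (hM : ∀ l, (M l).HasFullSupport) (S : Auctioneer K D b)
    (h : List (Round K D)) (l : Fin B) (a : Arm K (D l).m) (k : Fin (K + 1)) :
    0 ≤ resolve (instanceProb M S h l) a k :=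
  resolve_nonneg (fun i a => (instanceProb_pos hM S h l i a).le) a k

lemma sum_resolve_instanceProb (hM : ∀ l, (M l).HasFullSupport) (S : Auctioneer K D b)
    (h : List (Round K D)) (l : Fin B) (a : Arm K (D l).m) :
    ∑ k, resolve (instanceProb M S h l) a k = 1 :=
  sum_resolve (instanceProb_pos hM S h l) (sum_instanceProb M S h l) a

/-- The probability of the value, the pulled arm and the chosen option of one bidder in a
round. -/
noncomputable def bidderProb (M : (l : Fin B) → BanditAlg (Arm K (D l).m)) (S : Auctioneer K D b)
    (h : List (Round K D)) (l : Fin B) (x : Fin (D l).m × Arm K (D l).m × Fin (K + 1)) : ℝ :=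
  (D l).prob x.1 * instanceProb M S h l x.1 x.2.1 * resolve (instanceProb M S h l) x.2.1 x.2.2

lemma roundProb_eq_prod (M : (l : Fin B) → BanditAlg (Arm K (D l).m)) (S : Auctioneer K D b)
    (h : List (Round K D)) (r : Round K D) :
    roundProb M S h r = ∏ l, bidderProb M S h l (r l) := rfl

lemma bidderProb_nonneg (hM : ∀ l, (M l).HasFullSupport) (S : Auctioneer K D b)
    (h : List (Round K D)) (l : Fin B) (x : Fin (D l).m × Arm K (D l).m × Fin (K + 1)) :
    0 ≤ bidderProb M S h l x :=
  mul_nonneg (mul_nonneg ((D l).prob_pos _).le (instanceProb_pos hM S h l _ _).le)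
    (resolve_instanceProb_nonneg hM S h l _ _)

/-- A bidder's move is sampled in stages: value, arm, bid option. -/
lemma sum_bidderProb_mul (M : (l : Fin B) → BanditAlg (Arm K (D l).m)) (S : Auctioneer K D b)
    (h : List (Round K D)) (l : Fin B)
    (F : Fin (D l).m × Arm K (D l).m × Fin (K + 1) → ℝ) :
    ∑ x, bidderProb M S h l x * F x = ∑ i, (D l).prob i * ∑ a, instanceProb M S h l i a *
      ∑ k, resolve (instanceProb M S h l) a k * F (i, a, k) := by
  simp only [Fintype.sum_prod_type, Finset.mul_sum, bidderProb, mul_assoc]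

lemma sum_bidderProb_of_value (hM : ∀ l, (M l).HasFullSupport) (S : Auctioneer K D b)
    (h : List (Round K D)) (l : Fin B) (F : Fin (D l).m → ℝ) :
    ∑ x, bidderProb M S h l x * F x.1 = ∑ i, (D l).prob i * F i := by
  rw [sum_bidderProb_mul]
  simp only [weighted_sum_const _ (sum_resolve_instanceProb hM S h l _),
    weighted_sum_const _ (sum_instanceProb M S h l _)]

lemma sum_bidderProb (hM : ∀ l, (M l).HasFullSupport) (S : Auctioneer K D b)
    (h : List (Round K D)) (l : Fin B) : ∑ x, bidderProb M S h l x = 1 := by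
  simpa [(D l).prob_sum] using sum_bidderProb_of_value hM S h l fun _ => 1

lemma roundProb_nonneg (hM : ∀ l, (M l).HasFullSupport) (S : Auctioneer K D b)
    (h : List (Round K D)) (r : Round K D) : 0 ≤ roundProb M S h r :=
  Finset.prod_nonneg fun l _ => bidderProb_nonneg hM S h l (r l)

lemma sum_roundProb (hM : ∀ l, (M l).HasFullSupport) (S : Auctioneer K D b)
    (h : List (Round K D)) : ∑ r, roundProb M S h r = 1 :=
  FiniteProduct.sum_prod_eq_one _ (sum_bidderProb hM S h)

lemma sum_roundProb_resample (hM : ∀ l, (M l).HasFullSupport) (S : Auctioneer K D b)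
    (h : List (Round K D)) (l : Fin B) (F : Round K D → ℝ) :
    ∑ r, roundProb M S h r * F r = ∑ r, roundProb M S h r *
      ∑ x, bidderProb M S h l x * F (Function.update r l x) :=
  FiniteProduct.sum_resample (bidderProb M S h) l (sum_bidderProb hM S h l) F

/-- The values of a round are drawn independently from the given distributions. -/
lemma sum_roundProb_of_values (hM : ∀ l, (M l).HasFullSupport) (S : Auctioneer K D b)
    (h : List (Round K D)) (w : Profile D) :
    ∑ r, roundProb M S h r * (if valuesOf r = w then 1 else 0) = profileProb D w := by
  have h1 : ∀ r : Round K D, roundProb M S h r * (if valuesOf r = w then 1 else 0) =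
      ∏ l, (bidderProb M S h l (r l) * if (r l).1 = w l then 1 else 0) := fun r => by
    rw [Finset.prod_mul_distrib, Finset.prod_ite_zero, roundProb_eq_prod]
    simp [funext_iff, valuesOf]
  simp only [h1]
  rw [← Fintype.prod_sum fun l (x : Fin (D l).m × Arm K (D l).m × Fin (K + 1)) =>
    bidderProb M S h l x * if x.1 = w l then 1 else 0, profileProb]
  refine Finset.prod_congr rfl fun l _ => ?_
  rw [sum_bidderProb_of_value hM S h l fun i => if i = w l then 1 else 0]
  simp

lemma historyExpect_mono (hM : ∀ l, (M l).HasFullSupport) (S : Auctioneer K D b)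
    {F G : List (Round K D) → ℝ} (hFG : ∀ h, F h ≤ G h) (n : ℕ) (h : List (Round K D)) :
    historyExpect M S F n h ≤ historyExpect M S G n h := by
  induction n generalizing h with
  | zero => exact hFG h
  | succ n ih =>
    exact Finset.sum_le_sum fun r _ =>
      mul_le_mul_of_nonneg_left (ih _) (roundProb_nonneg hM S h r)

lemma historyExpect_const (hM : ∀ l, (M l).HasFullSupport) (S : Auctioneer K D b)
    (c : ℝ) (n : ℕ) (h : List (Round K D)) : historyExpect M S (fun _ => c) n h = c := by
  induction n generalizing h with
  | zero => rfl
  | succ n ih => simp only [historyExpect, ih, weighted_sum_const _ (sum_roundProb hM S h)]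

lemma historyExpect_const_mul (M : (l : Fin B) → BanditAlg (Arm K (D l).m))
    (S : Auctioneer K D b) (c : ℝ) (F : List (Round K D) → ℝ) (n : ℕ) (h : List (Round K D)) :
    historyExpect M S (fun h => c * F h) n h = c * historyExpect M S F n h := by
  induction n generalizing h with
  | zero => rfl
  | succ n ih => simp only [historyExpect, ih, Finset.mul_sum, mul_left_comm]

lemma historyExpect_sum {ι : Type*} (s : Finset ι) (M : (l : Fin B) → BanditAlg (Arm K (D l).m))
    (S : Auctioneer K D b) (F : ι → List (Round K D) → ℝ) (n : ℕ) (h : List (Round K D)) :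
    historyExpect M S (fun h => ∑ x ∈ s, F x h) n h = ∑ x ∈ s, historyExpect M S (F x) n h := by
  induction n generalizing h with
  | zero => rfl
  | succ n ih =>
    simp only [historyExpect, ih, Finset.mul_sum]
    exact Finset.sum_comm

/-- The expected total of `f`, a function of the past and of the round, over `n` further rounds
from the history `h`. -/
noncomputable def cumExpect (M : (l : Fin B) → BanditAlg (Arm K (D l).m)) (S : Auctioneer K D b)
    (f : List (Round K D) → Round K D → ℝ) : ℕ → List (Round K D) → ℝ
  | 0, _ => 0
  | n + 1, h => ∑ r, roundProb M S h r * (f h r + cumExpect M S f n (r :: h))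

lemma cumExpect_eq_sum (M : (l : Fin B) → BanditAlg (Arm K (D l).m)) (S : Auctioneer K D b)
    (f : List (Round K D) → Round K D → ℝ) (n : ℕ) (h : List (Round K D)) :
    cumExpect M S f n h =
      ∑ t ∈ Finset.range n, historyExpect M S (fun h => ∑ r, roundProb M S h r * f h r) t h := by
  induction n generalizing h with
  | zero => rfl
  | succ n ih =>
    rw [Finset.sum_range_succ']
    simp only [cumExpect, ih, historyExpect, mul_add, Finset.sum_add_distrib, Finset.mul_sum]
    rw [add_comm, Finset.sum_comm]

/-- Tower property: only the conditional mean of each round given the past matters. -/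
lemma cumExpect_congr (M : (l : Fin B) → BanditAlg (Arm K (D l).m)) (S : Auctioneer K D b)
    {f g : List (Round K D) → Round K D → ℝ}
    (hfg : ∀ h, ∑ r, roundProb M S h r * f h r = ∑ r, roundProb M S h r * g h r) (n : ℕ)
    (h : List (Round K D)) : cumExpect M S f n h = cumExpect M S g n h := by
  simp only [cumExpect_eq_sum, hfg]

lemma cumExpect_const_mul (M : (l : Fin B) → BanditAlg (Arm K (D l).m)) (S : Auctioneer K D b)
    (c : ℝ) (f : List (Round K D) → Round K D → ℝ) (n : ℕ) (h : List (Round K D)) :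
    cumExpect M S (fun h r => c * f h r) n h = c * cumExpect M S f n h := by
  induction n generalizing h with
  | zero => simp [cumExpect]
  | succ n ih =>
    simp only [cumExpect, ih, Finset.mul_sum]
    exact Finset.sum_congr rfl fun r _ => by ring

lemma cumExpect_sum {ι : Type*} (s : Finset ι) (M : (l : Fin B) → BanditAlg (Arm K (D l).m))
    (S : Auctioneer K D b) (f : ι → List (Round K D) → Round K D → ℝ) (n : ℕ)
    (h : List (Round K D)) :
    cumExpect M S (fun h r => ∑ x ∈ s, f x h r) n h = ∑ x ∈ s, cumExpect M S (f x) n h := by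
  induction n generalizing h with
  | zero => simp [cumExpect]
  | succ n ih =>
    simp only [cumExpect, ih, ← Finset.sum_add_distrib, Finset.mul_sum]
    exact Finset.sum_comm

lemma cumExpect_sub (M : (l : Fin B) → BanditAlg (Arm K (D l).m)) (S : Auctioneer K D b)
    (f g : List (Round K D) → Round K D → ℝ) (n : ℕ) (h : List (Round K D)) :
    cumExpect M S (fun h r => f h r - g h r) n h =
      cumExpect M S f n h - cumExpect M S g n h := by
  induction n generalizing h with
  | zero => simp [cumExpect]
  | succ n ih =>
    simp only [cumExpect, ih, ← Finset.sum_sub_distrib]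
    exact Finset.sum_congr rfl fun r _ => by ring

lemma historyExpect_totalPayments (hM : ∀ l, (M l).HasFullSupport) (S : Auctioneer K D b)
    (n : ℕ) (h : List (Round K D)) :
    historyExpect M S (totalPayments S) n h = totalPayments S h +
      cumExpect M S (fun h r => ∑ l, (S h).price (bidsOf r) l) n h := by
  induction n generalizing h with
  | zero => simp [historyExpect, cumExpect]
  | succ n ih =>
    have h1 := weighted_sum_const _ (sum_roundProb hM S h) (totalPayments S h)
    simp only [historyExpect, cumExpect, ih, totalPayments]
    rw [← h1, ← Finset.sum_add_distrib]
    refine Finset.sum_congr rfl fun r _ => ?_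
    rw [h1]
    ring

end Rounds

end NoRegretAuction

/-! ### Expected regret against a fixed arm. -/

namespace NoRegretAuction

namespace BanditAlg

variable {A : Type} [Fintype A]

lemma expect_mono (M : BanditAlg A) (adv : List A → A → ℝ) {F G : List A → ℝ}
    (hFG : ∀ h, F h ≤ G h) (n : ℕ) (h : List A) : M.expect adv F n h ≤ M.expect adv G n h := by
  induction n generalizing h with
  | zero => exact hFG h
  | succ n ih =>
    exact Finset.sum_le_sum fun a _ => mul_le_mul_of_nonneg_left (ih _) (M.prob_nonneg _ _)

/-- Expected regret against arm `j` over `n` further rounds after the observations `fb`, when the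
rewards are `s t` in the round that follows the further pulls `t` (oldest first). -/
noncomputable def armRegret (M : BanditAlg A) (j : A) :
    ℕ → List (A × ℝ) → (List A → A → ℝ) → ℝ
  | 0, _, _ => 0
  | n + 1, fb, s => s [] j + ∑ a, M.prob fb a *
      (armRegret M j n ((a, s [] a) :: fb) (fun t => s (a :: t)) - s [] a)

lemma armRegret_zero (M : BanditAlg A) (j : A) (n : ℕ) (fb : List (A × ℝ)) :
    M.armRegret j n fb (fun _ _ => 0) = 0 := by
  induction n generalizing fb with
  | zero => rfl
  | succ n ih => simp [armRegret, ih]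

/-- Histories are newest first, while the strategies in `armRegret` read pulls oldest first so that
play after a first pull `a` is just `fun t => s (a :: t)`. Hence the reversal. -/
lemma expect_armTotal_sub_earned (M : BanditAlg A) (adv : List A → A → ℝ) (j : A) (n : ℕ)
    (h : List A) :
    M.expect adv (fun h => armTotal adv j h - earned adv h) n h =
      armTotal adv j h - earned adv h +
        M.armRegret j n (feedback adv h) (fun t => adv (t.reverse ++ h)) := by
  induction n generalizing h with
  | zero => simp [expect, armRegret]
  | succ n ih =>
    have hc := weighted_sum_const _ (M.prob_sum (feedback adv h))
      (armTotal adv j h - earned adv h + adv h j)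
    simp only [expect, armRegret, ih, feedback, armTotal, earned, List.reverse_nil,
      List.nil_append, List.reverse_cons, List.append_assoc, List.cons_append]
    rw [← add_assoc, ← hc, ← Finset.sum_add_distrib]
    refine Finset.sum_congr rfl fun a _ => ?_
    ring

lemma IsNoRegret.armRegret_le {M : BanditAlg A} {T : ℕ} {δ : ℝ} (hM : M.IsNoRegret T δ) (j : A)
    {s : List A → A → ℝ} (hs : ∀ t a, s t a ∈ Set.Icc (-1 : ℝ) 1) : M.armRegret j T [] s ≤ δ := by
  have h1 := hM (fun h => s h.reverse) fun h a => hs _ a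
  have h2 := M.expect_mono (fun h => s h.reverse)
    (F := fun h => armTotal (fun h => s h.reverse) j h - earned (fun h => s h.reverse) h)
    (G := regret fun h => s h.reverse)
    (fun h => sub_le_sub_right (le_ciSup (f := fun j => armTotal (fun h => s h.reverse) j h)
      (Set.finite_range _).bddAbove j) _) T []
  rw [expect_armTotal_sub_earned] at h2
  simpa [armTotal, earned, feedback] using h2.trans h1

/-- The adversary with all rewards zero causes no regret. -/
lemma IsNoRegret.nonneg [Nonempty A] {M : BanditAlg A} {T : ℕ} {δ : ℝ} (hM : M.IsNoRegret T δ) :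
    0 ≤ δ := by
  obtain ⟨j⟩ := ‹Nonempty A›
  rw [← M.armRegret_zero j T []]
  exact hM.armRegret_le j fun _ _ => by norm_num

end BanditAlg

/-! ### The auction as an adversary of a single instance. -/

section Regret

variable {B K : ℕ} {D : Fin B → ValueDist} {b : Fin (K + 1) → ℝ}
  {M : (l : Fin B) → BanditAlg (Arm K (D l).m)} {S : Auctioneer K D b}

/-- Utility of bidder `l` with the value of index `i` when the chosen options are `β`. -/
noncomputable def optionUtility (D : Fin B → ValueDist) (R : AuctionRule B K b) (l : Fin B)
    (i : Fin (D l).m) (β : Fin B → Fin (K + 1)) : ℝ :=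
  (D l).val i * R.alloc β l - R.price β l

lemma alloc_le_one (R : AuctionRule B K b) (β : Fin B → Fin (K + 1)) (l : Fin B) :
    R.alloc β l ≤ 1 :=
  (Finset.single_le_sum (fun l _ => R.alloc_nonneg β l) (Finset.mem_univ l)).trans
    (R.alloc_sum_le β)

lemma price_le_alloc (hb : ∀ k, b k ∈ Set.Icc (0 : ℝ) 1) (R : AuctionRule B K b)
    (β : Fin B → Fin (K + 1)) (l : Fin B) : R.price β l ≤ R.alloc β l :=
  (R.price_le β l).trans (mul_le_of_le_one_right (R.alloc_nonneg β l) (hb _).2)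

lemma optionUtility_mem (hb : ∀ k, b k ∈ Set.Icc (0 : ℝ) 1) (R : AuctionRule B K b) (l : Fin B)
    (i : Fin (D l).m) (β : Fin B → Fin (K + 1)) :
    optionUtility D R l i β ∈ Set.Icc (-1 : ℝ) 1 := by
  have h1 := alloc_le_one R β l
  have h2 := price_le_alloc hb R β l
  have h3 := R.price_nonneg β l
  have h4 := mul_nonneg ((D l).val_nonneg i) (R.alloc_nonneg β l)
  have h5 := mul_le_of_le_one_left (R.alloc_nonneg β l) ((D l).val_le_one i)
  rw [optionUtility]
  constructor <;> linarith

lemma bidsOf_update (r : Round K D) (l : Fin B)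
    (x : Fin (D l).m × Arm K (D l).m × Fin (K + 1)) :
    bidsOf (Function.update r l x) = Function.update (bidsOf r) l x.2.2 := by
  funext l'
  by_cases h : l' = l
  · subst h; simp [bidsOf]
  · simp [bidsOf, h]

/-- Expected utility of bidder `l` with the value of index `i` from pulling the arm `a`, when the
options of the other bidders are as in `β`. -/
noncomputable def armUtility (M : (l : Fin B) → BanditAlg (Arm K (D l).m))
    (S : Auctioneer K D b) (h : List (Round K D)) (l : Fin B) (i : Fin (D l).m)
    (a : Arm K (D l).m) (β : Fin B → Fin (K + 1)) : ℝ :=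
  ∑ k, resolve (instanceProb M S h l) a k * optionUtility D (S h) l i (Function.update β l k)

lemma armUtility_update (M : (l : Fin B) → BanditAlg (Arm K (D l).m))
    (S : Auctioneer K D b) (h : List (Round K D)) (l : Fin B) (i : Fin (D l).m)
    (a : Arm K (D l).m) (β : Fin B → Fin (K + 1)) (k : Fin (K + 1)) :
    armUtility M S h l i a (Function.update β l k) = armUtility M S h l i a β := by
  simp [armUtility]

/-- In the rounds in which bidder `l` has the value of index `i`: the gain from pulling the arm
`a` instead of the arm that was pulled. -/
noncomputable def armGain (M : (l : Fin B) → BanditAlg (Arm K (D l).m))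
    (S : Auctioneer K D b) (l : Fin B) (i : Fin (D l).m) (a : Arm K (D l).m)
    (h : List (Round K D)) (r : Round K D) : ℝ :=
  if (r l).1 = i then armUtility M S h l i a (bidsOf r) - optionUtility D (S h) l i (bidsOf r)
  else 0

/-- One round of an instance against rewards that depend on the resolution of the value arms:
the resolution can be fixed, separately for every arm, without lowering the expected regret. -/
lemma exists_resolution {A C : Type} [Fintype A] [DecidableEq A] [Fintype C] (p : A → ℝ)
    (hs : ∑ a, p a = 1) (q : A → C → ℝ) (hq : ∀ a c, 0 ≤ q a c) (hqs : ∀ a, ∑ c, q a c = 1)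
    (j : A) (U : C → ℝ) (V : A → C → ℝ) :
    ∃ κ : A → C, ∑ a, p a * ∑ c, q a c * ((∑ c', q j c' * U c') - U c + V a c) ≤
      U (κ j) + ∑ a, p a * (V a (κ a) - U (κ a)) := by
  -- The objective is a sum over arms `a` of a `q a`-average of this function of `c`, so the
  -- resolutions can be optimized separately. The comparator term is charged to arm `j` alone.
  choose κ hκ using fun a => exists_weighted_sum_le (q a) (hq a) (hqs a)
    (fun c => p a * (V a c - U c) + if a = j then U c else 0)
  refine ⟨κ, ?_⟩
  calc ∑ a, p a * ∑ c, q a c * ((∑ c', q j c' * U c') - U c + V a c)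
      = ∑ a, (p a * ∑ c', q j c' * U c') + ∑ a, ∑ c, q a c * (p a * (V a c - U c)) := by
        rw [← Finset.sum_add_distrib]
        refine Finset.sum_congr rfl fun a _ => ?_
        generalize ∑ c', q j c' * U c' = e
        conv_rhs => rw [← weighted_sum_const (q a) (hqs a) e]
        rw [Finset.mul_sum, Finset.mul_sum, ← Finset.sum_add_distrib]
        exact Finset.sum_congr rfl fun c _ => by ring
    _ = ∑ a, ∑ c, q a c * (p a * (V a c - U c) + if a = j then U c else 0) := by
        rw [weighted_sum_const p hs]
        simp only [mul_add, Finset.sum_add_distrib]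
        simp [Finset.sum_ite_irrel, add_comm]
    _ ≤ ∑ a, (p a * (V a (κ a) - U (κ a)) + if a = j then U (κ a) else 0) :=
        Finset.sum_le_sum fun a _ => hκ a
    _ = _ := by
        rw [Finset.sum_add_distrib]
        simp [add_comm]

/-- Whatever the instance does not control is fixed round by round at a choice at least as good as
the average. Only the pulled arms of this instance stay random, which leaves an admissible
adversary. The instance plays in at most `n` of the auction rounds; `N ≥ n` leaves room to pad its
own horizon. -/
lemma exists_strategy (hM : ∀ l, (M l).HasFullSupport) (hb : ∀ k, b k ∈ Set.Icc (0 : ℝ) 1)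
    (S : Auctioneer K D b) (l : Fin B) (i : Fin (D l).m) (j : Arm K (D l).m) (n : ℕ) :
    ∀ (N : ℕ) (_ : n ≤ N) (h : List (Round K D)),
      ∃ s : List (Arm K (D l).m) → Arm K (D l).m → ℝ, (∀ t a, s t a ∈ Set.Icc (-1 : ℝ) 1) ∧
        cumExpect M S (armGain M S l i j) n h ≤
          (M l).armRegret j N (instanceHistory S l i h) s := by
  classical
  induction n with
  | zero =>
    intro N _ h
    -- Unused rounds of the instance get zero rewards, which add no regret.
    refine ⟨fun _ _ => 0, fun _ _ => by norm_num, ?_⟩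
    rw [BanditAlg.armRegret_zero]
    exact le_rfl
  | succ n ih =>
    intro N hN h
    -- Fixing `r` fixes the moves of the other bidders; coordinate `l` is resampled and stays
    -- random.
    obtain ⟨r, hr⟩ := exists_weighted_sum_le _ (roundProb_nonneg hM S h) (sum_roundProb hM S h)
      fun r => ∑ x, bidderProb M S h l x * (armGain M S l i j h (Function.update r l x) +
        cumExpect M S (armGain M S l i j) n (Function.update r l x :: h))
    rw [← sum_roundProb_resample hM S h l fun r => armGain M S l i j h r +
      cumExpect M S (armGain M S l i j) n (r :: h)] at hr
    change cumExpect M S (armGain M S l i j) (n + 1) h ≤ _ at hr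
    rw [sum_bidderProb_mul] at hr
    obtain ⟨i', hi'⟩ := exists_weighted_sum_le _ (fun i => ((D l).prob_pos i).le) (D l).prob_sum
      fun i' => ∑ a, instanceProb M S h l i' a * ∑ k, resolve (instanceProb M S h l) a k *
        (armGain M S l i j h (Function.update r l (i', a, k)) +
          cumExpect M S (armGain M S l i j) n (Function.update r l (i', a, k) :: h))
    replace hr := hr.trans hi'
    by_cases hii : i' = i
    · subst hii
      obtain ⟨N, rfl⟩ : ∃ N', N = N' + 1 := ⟨N - 1, by omega⟩
      set U : Fin (K + 1) → ℝ := fun k =>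
        optionUtility D (S h) l i' (Function.update (bidsOf r) l k) with hU
      obtain ⟨κ, hκ⟩ := exists_resolution _ (sum_instanceProb M S h l i')
        (resolve (instanceProb M S h l)) (resolve_instanceProb_nonneg hM S h l)
        (sum_resolve_instanceProb hM S h l) j U
        fun a k => cumExpect M S (armGain M S l i' j) n (Function.update r l (i', a, k) :: h)
      -- With a resolution fixed for each arm, each pull leads to a single next history; the
      -- strategies for these histories are glued along the first pull.
      choose s hs hsV using fun a =>
        ih N (by omega) (Function.update r l (i', a, κ a) :: h)
      refine ⟨fun t => match t with
        | [] => fun a => U (κ a)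
        | a :: t => s a t, ?_, ?_⟩
      · rintro (_ | ⟨a, t⟩) a'
        · exact optionUtility_mem hb _ _ _ _
        · exact hs a t a'
      · simp only [armGain, Function.update_self, if_true, bidsOf_update, armUtility_update] at hr
        refine hr.trans (hκ.trans ?_)
        simp only [BanditAlg.armRegret]
        refine add_le_add_right (Finset.sum_le_sum fun a _ => mul_le_mul_of_nonneg_left
          (sub_le_sub_right ((hsV a).trans_eq ?_) _) ((M l).prob_nonneg _ _)) _
        simp only [instanceHistory, Function.update_self, if_true, roundUtility, bidsOf_update,
          hU, optionUtility]
    -- Another instance plays: its arm and option are fixed as well, and the remaining horizon `N`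
    -- is not consumed.
    · obtain ⟨a, ha⟩ := exists_weighted_sum_le _
        (fun a => (instanceProb_pos hM S h l i' a).le) (sum_instanceProb M S h l i')
        fun a => ∑ k, resolve (instanceProb M S h l) a k *
          (armGain M S l i j h (Function.update r l (i', a, k)) +
            cumExpect M S (armGain M S l i j) n (Function.update r l (i', a, k) :: h))
      obtain ⟨k, hk⟩ := exists_weighted_sum_le _
        (resolve_instanceProb_nonneg hM S h l a) (sum_resolve_instanceProb hM S h l a)
        fun k => (armGain M S l i j h (Function.update r l (i', a, k)) +
            cumExpect M S (armGain M S l i j) n (Function.update r l (i', a, k) :: h))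
      replace hr := hr.trans (ha.trans hk)
      simp only [armGain, Function.update_self, if_neg hii, zero_add] at hr
      obtain ⟨s, hs, hsV⟩ := ih N (by omega) (Function.update r l (i', a, k) :: h)
      refine ⟨s, hs, hr.trans (hsV.trans_eq ?_)⟩
      simp [instanceHistory, hii]

/-- The no-regret guarantee of a bidder's algorithm holds for the rounds of each instance. -/
lemma cumExpect_armGain_le (hM : ∀ l, (M l).HasFullSupport)
    (hb : ∀ k, b k ∈ Set.Icc (0 : ℝ) 1) {T : ℕ} {δ : ℝ} {l : Fin B}
    (hδ : (M l).IsNoRegret T δ) (S : Auctioneer K D b) (i : Fin (D l).m)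
    (j : Arm K (D l).m) : cumExpect M S (armGain M S l i j) T [] ≤ δ := by
  obtain ⟨s, hs, hle⟩ := exists_strategy hM hb S l i j T T le_rfl []
  exact hle.trans (hδ.armRegret_le j hs)

end Regret

end NoRegretAuction

namespace NoRegretAuction

/-! ### Independent value profiles and the smallest probability. -/

section Profiles

variable {B : ℕ} {D : Fin B → ValueDist}

lemma profileProb_pos (D : Fin B → ValueDist) (w : Profile D) : 0 < profileProb D w :=
  Finset.prod_pos fun l _ => (D l).prob_pos (w l)

lemma sum_profileProb (D : Fin B → ValueDist) : ∑ w, profileProb D w = 1 :=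
  FiniteProduct.sum_prod_eq_one _ fun l => (D l).prob_sum

lemma sum_profileProb_resample (D : Fin B → ValueDist) (l : Fin B) (F : Profile D → ℝ) :
    ∑ w, profileProb D w * F w =
      ∑ j, (D l).prob j * ∑ w, profileProb D w * F (Function.update w l j) := by
  rw [show ∑ w, profileProb D w * F w = _ from
    FiniteProduct.sum_resample (fun l => (D l).prob) l (D l).prob_sum F]
  simp only [Finset.mul_sum]
  rw [Finset.sum_comm]
  exact Finset.sum_congr rfl fun j _ => Finset.sum_congr rfl fun w _ => by
    rw [profileProb]; ring

lemma prob_mul_sum_update (D : Fin B → ValueDist) (l : Fin B) (j : Fin (D l).m)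
    (F : Profile D → ℝ) :
    (D l).prob j * ∑ w, profileProb D w * F (Function.update w l j) =
      ∑ w, profileProb D w * ((if w l = j then 1 else 0) * F w) := by
  symm
  rw [sum_profileProb_resample D l]
  simp

lemma qMin_le (D : Fin B → ValueDist) (l : Fin B) (i : Fin (D l).m) : qMin D ≤ (D l).prob i :=
  ciInf_le (f := fun x : (l : Fin B) × Fin (D l).m => (D x.1).prob x.2)
    (Set.finite_range _).bddBelow ⟨l, i⟩

lemma ValueDist.nonempty (d : ValueDist) : Nonempty (Fin d.m) := by
  by_contra h
  rw [not_nonempty_iff] at h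
  simpa using d.prob_sum

lemma qMin_pos (D : Fin B → ValueDist) (l : Fin B) : 0 < qMin D := by
  obtain ⟨i⟩ := (D l).nonempty
  have : Nonempty ((l : Fin B) × Fin (D l).m) := ⟨⟨l, i⟩⟩
  obtain ⟨x, hx⟩ := exists_eq_ciInf_of_finite
    (f := fun x : (l : Fin B) × Fin (D l).m => (D x.1).prob x.2)
  rw [qMin, ← hx]
  exact (D x.1).prob_pos x.2

end Profiles

/-! ### From regret to the incentives of the time-averaged mechanism. -/

section TimeAveraged

variable {B K : ℕ} {D : Fin B → ValueDist} {b : Fin (K + 1) → ℝ}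
  {M : (l : Fin B) → BanditAlg (Arm K (D l).m)} {S : Auctioneer K D b}

lemma profileProb_mul_condRoundExpect (M : (l : Fin B) → BanditAlg (Arm K (D l).m))
    (S : Auctioneer K D b) (f : List (Round K D) → Round K D → ℝ) (t : ℕ) (w : Profile D) :
    profileProb D w * condRoundExpect M S f t w =
      historyExpect M S
        (fun h => ∑ r, roundProb M S h r * if valuesOf r = w then f h r else 0) t [] :=
  mul_div_cancel₀ _ (profileProb_pos D w).ne'

/-- Averaging the conditional expectations over the values gives expectations over the rounds. -/
lemma sum_profileProb_mul_condRoundExpect (M : (l : Fin B) → BanditAlg (Arm K (D l).m))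
    (S : Auctioneer K D b) (c : Profile D → ℝ) (f : List (Round K D) → Round K D → ℝ) (T : ℕ) :
    ∑ w, profileProb D w * (c w * ((∑ t ∈ Finset.range T, condRoundExpect M S f t w) / T)) =
      cumExpect M S (fun h r => c (valuesOf r) * f h r) T [] / T := by
  have h1 : ∀ w, profileProb D w *
      (c w * ((∑ t ∈ Finset.range T, condRoundExpect M S f t w) / T)) =
      (∑ t ∈ Finset.range T, historyExpect M S
        (fun h => c w * ∑ r, roundProb M S h r * if valuesOf r = w then f h r else 0) t []) / T := by
    intro w
    simp only [historyExpect_const_mul, ← profileProb_mul_condRoundExpect, ← Finset.mul_sum]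
    ring
  simp only [h1]
  rw [← Finset.sum_div, Finset.sum_comm, cumExpect_eq_sum]
  simp only [← historyExpect_sum]
  congr 1
  refine Finset.sum_congr rfl fun t _ => ?_
  congr 1
  funext h
  simp only [Finset.mul_sum]
  rw [Finset.sum_comm]
  refine Finset.sum_congr rfl fun r _ => ?_
  rw [Finset.sum_eq_single (valuesOf r)]
  · simp only [if_true]; ring
  · intro w _ hw
    rw [if_neg (Ne.symm hw)]
    ring
  · simp

lemma condRoundExpect_mono (hM : ∀ l, (M l).HasFullSupport) (S : Auctioneer K D b)
    {f g : List (Round K D) → Round K D → ℝ} (hfg : ∀ h r, f h r ≤ g h r) (t : ℕ)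
    (w : Profile D) : condRoundExpect M S f t w ≤ condRoundExpect M S g t w := by
  refine div_le_div_of_nonneg_right (historyExpect_mono hM S (fun h => ?_) t [])
    (profileProb_pos D w).le
  refine Finset.sum_le_sum fun r _ => mul_le_mul_of_nonneg_left ?_ (roundProb_nonneg hM S h r)
  split_ifs
  · exact hfg h r
  · exact le_rfl

lemma condRoundExpect_one (hM : ∀ l, (M l).HasFullSupport) (S : Auctioneer K D b) (t : ℕ)
    (w : Profile D) : condRoundExpect M S (fun _ _ => 1) t w = 1 := by
  simp only [condRoundExpect, sum_roundProb_of_values hM, historyExpect_const hM]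
  exact div_self (profileProb_pos D w).ne'

lemma condRoundExpect_zero (hM : ∀ l, (M l).HasFullSupport) (S : Auctioneer K D b) (t : ℕ)
    (w : Profile D) : condRoundExpect M S (fun _ _ => 0) t w = 0 := by
  simp [condRoundExpect, historyExpect_const hM]

lemma condRoundExpect_sum {ι : Type*} (s : Finset ι)
    (M : (l : Fin B) → BanditAlg (Arm K (D l).m)) (S : Auctioneer K D b)
    (f : ι → List (Round K D) → Round K D → ℝ) (t : ℕ) (w : Profile D) :
    condRoundExpect M S (fun h r => ∑ x ∈ s, f x h r) t w =
      ∑ x ∈ s, condRoundExpect M S (f x) t w := by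
  simp only [condRoundExpect]
  rw [← Finset.sum_div, ← historyExpect_sum]
  congr 2
  funext h
  rw [Finset.sum_comm]
  refine Finset.sum_congr rfl fun r _ => ?_
  rw [← Finset.mul_sum]
  split_ifs <;> simp

lemma timeAveraged_isFeasible (hM : ∀ l, (M l).HasFullSupport) (S : Auctioneer K D b) (T : ℕ) :
    (timeAveraged M S T).IsFeasible := by
  constructor
  · intro w l
    refine div_nonneg (Finset.sum_nonneg fun t _ => ?_) T.cast_nonneg
    rw [← condRoundExpect_zero hM S t w]
    exact condRoundExpect_mono hM S (fun h r => (S h).alloc_nonneg _ _) t w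
  · intro w
    simp only [timeAveraged]
    rw [← Finset.sum_div, Finset.sum_comm]
    simp only [← condRoundExpect_sum]
    refine div_le_one_of_le₀ ?_ T.cast_nonneg
    calc _ ≤ ∑ t ∈ Finset.range T, condRoundExpect M S (fun _ _ => 1) t w :=
          Finset.sum_le_sum fun t _ =>
            condRoundExpect_mono hM S (fun h r => (S h).alloc_sum_le _) t w
      _ = T := by simp [condRoundExpect_one hM]

lemma timeAveraged_pay_le_alloc (hM : ∀ l, (M l).HasFullSupport)
    (hb : ∀ k, b k ∈ Set.Icc (0 : ℝ) 1) (S : Auctioneer K D b) (T : ℕ) (w : Profile D)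
    (l : Fin B) : (timeAveraged M S T).pay w l ≤ (timeAveraged M S T).alloc w l :=
  div_le_div_of_nonneg_right (Finset.sum_le_sum fun t _ =>
    condRoundExpect_mono hM S (fun h _ => price_le_alloc hb (S h) _ _) t w) T.cast_nonneg

lemma timeAveraged_revenue (hM : ∀ l, (M l).HasFullSupport) (S : Auctioneer K D b) (T : ℕ) :
    expectedRevenue M S T = T * (timeAveraged M S T).revenue := by
  rcases Nat.eq_zero_or_pos T with rfl | hT
  · simp [expectedRevenue, historyExpect, totalPayments]
  have hT' : (T : ℝ) ≠ 0 := by positivity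
  have h1 : (timeAveraged M S T).revenue =
      ∑ l, cumExpect M S (fun h r => (S h).price (bidsOf r) l) T [] / T := by
    simp only [DirectMechanism.revenue, timeAveraged, Finset.mul_sum]
    rw [Finset.sum_comm]
    refine Finset.sum_congr rfl fun l _ => ?_
    simpa using sum_profileProb_mul_condRoundExpect M S (fun _ => 1)
      (fun h r => (S h).price (bidsOf r) l) T
  rw [h1, ← Finset.sum_div, mul_div_cancel₀ _ hT', expectedRevenue, historyExpect_totalPayments hM,
    cumExpect_sum]
  simp [totalPayments]

/-- Reporting `j` means receiving the outcomes of the rounds with own value `j`, judged with value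
`i`; the factor `prob j` undoes the conditioning. -/
lemma prob_mul_interimUtility_timeAveraged (M : (l : Fin B) → BanditAlg (Arm K (D l).m))
    (S : Auctioneer K D b) (T : ℕ) (l : Fin B) (i j : Fin (D l).m) :
    (D l).prob j * (timeAveraged M S T).interimUtility l i j =
      cumExpect M S (fun h r => if (r l).1 = j then optionUtility D (S h) l i (bidsOf r) else 0)
        T [] / T := by
  have h1 : ∀ h (r : Round K D),
      (if (r l).1 = j then optionUtility D (S h) l i (bidsOf r) else 0) =
      (D l).val i * ((if valuesOf r l = j then 1 else 0) * (S h).alloc (bidsOf r) l) -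
      (if valuesOf r l = j then 1 else 0) * (S h).price (bidsOf r) l := fun h r => by
    by_cases hj : (r l).1 = j <;> simp [valuesOf, optionUtility, hj]
  simp only [h1]
  rw [cumExpect_sub, cumExpect_const_mul, sub_div, mul_div_assoc,
    ← sum_profileProb_mul_condRoundExpect M S (fun w => if w l = j then 1 else 0),
    ← sum_profileProb_mul_condRoundExpect M S (fun w => if w l = j then 1 else 0),
    DirectMechanism.interimUtility, prob_mul_sum_update D l j
      fun w => (D l).val i * (timeAveraged M S T).alloc w l - (timeAveraged M S T).pay w l,
    Finset.mul_sum, ← Finset.sum_sub_distrib]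
  exact Finset.sum_congr rfl fun w _ => by simp only [timeAveraged]; ring

/-- Given value `j`, the chosen option is distributed as the resolution of the value arm of `j`, by
the fixed-point equation `resolve_inr`, and it is independent of the other bidders given the past.
-/
lemma sum_roundProb_optionUtility (hM : ∀ l, (M l).HasFullSupport) (S : Auctioneer K D b)
    (h : List (Round K D)) (l : Fin B) (i j : Fin (D l).m) :
    ∑ r, roundProb M S h r *
        (if (r l).1 = j then optionUtility D (S h) l i (bidsOf r) else 0) =
      (D l).prob j * ∑ r, roundProb M S h r * armUtility M S h l i (Sum.inr j) (bidsOf r) := by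
  rw [sum_roundProb_resample hM S h l, Finset.mul_sum]
  refine Finset.sum_congr rfl fun r _ => ?_
  rw [sum_bidderProb_mul, mul_left_comm]
  congr 1
  simp only [Function.update_self, bidsOf_update]
  rw [Finset.sum_eq_single j]
  · simp only [if_true, armUtility]
    congr 1
    simp only [resolve_inr (fun i a => (instanceProb_pos hM S h l i a).le)
      (sum_instanceProb M S h l), Finset.sum_mul, Finset.mul_sum, mul_assoc]
    exact Finset.sum_comm
  · intro i' _ hi'
    simp [hi']
  · simp

lemma sum_roundProb_armUtility (hM : ∀ l, (M l).HasFullSupport) (S : Auctioneer K D b)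
    (h : List (Round K D)) (l : Fin B) (i : Fin (D l).m) (a : Arm K (D l).m) :
    ∑ r, roundProb M S h r *
        (if (r l).1 = i then armUtility M S h l i a (bidsOf r) else 0) =
      (D l).prob i * ∑ r, roundProb M S h r * armUtility M S h l i a (bidsOf r) := by
  rw [sum_roundProb_resample hM S h l, Finset.mul_sum]
  refine Finset.sum_congr rfl fun r _ => ?_
  rw [mul_left_comm]
  congr 1
  simp only [Function.update_self, bidsOf_update, armUtility_update]
  rw [sum_bidderProb_of_value hM S h l
    fun i' => if i' = i then armUtility M S h l i a (bidsOf r) else 0]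
  simp

/-- Here regret against a value arm becomes a Bayesian incentive constraint. The two utilities are
observed in rounds with different own values, so the per-round means are compared after multiplying
by `prob j`. -/
lemma cumExpect_armGain_inr (hM : ∀ l, (M l).HasFullSupport) (S : Auctioneer K D b) (T : ℕ)
    (l : Fin B) (i j : Fin (D l).m) :
    cumExpect M S (armGain M S l i (Sum.inr j)) T [] = (D l).prob i * T *
      ((timeAveraged M S T).interimUtility l i j - (timeAveraged M S T).interimUtility l i i) := by
  rcases Nat.eq_zero_or_pos T with rfl | hT
  · simp [cumExpect]
  have hT' : (T : ℝ) ≠ 0 := by positivity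
  have hj := (D l).prob_pos j
  have h1 := prob_mul_interimUtility_timeAveraged M S T l i j
  have h2 := prob_mul_interimUtility_timeAveraged M S T l i i
  rw [eq_div_iff hT'] at h1 h2
  have h3 : cumExpect M S (fun h r => (D l).prob j * armGain M S l i (Sum.inr j) h r) T [] =
      cumExpect M S (fun h r =>
        (D l).prob i * (if (r l).1 = j then optionUtility D (S h) l i (bidsOf r) else 0) -
        (D l).prob j * (if (r l).1 = i then optionUtility D (S h) l i (bidsOf r) else 0)) T [] := by
    refine cumExpect_congr M S (fun h => ?_) T []
    have h4 : ∀ r, roundProb M S h r * ((D l).prob j * armGain M S l i (Sum.inr j) h r) =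
        (D l).prob j * (roundProb M S h r *
          (if (r l).1 = i then armUtility M S h l i (Sum.inr j) (bidsOf r) else 0)) -
        (D l).prob j * (roundProb M S h r *
          (if (r l).1 = i then optionUtility D (S h) l i (bidsOf r) else 0)) := fun r => by
      rw [armGain]
      split_ifs <;> ring
    simp only [h4, mul_sub, Finset.sum_sub_distrib, mul_left_comm (roundProb M S h _),
      ← Finset.mul_sum, sum_roundProb_armUtility hM, sum_roundProb_optionUtility hM]
    ring
  rw [cumExpect_const_mul, cumExpect_sub, cumExpect_const_mul, cumExpect_const_mul, ← h1, ← h2]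
    at h3
  apply mul_left_cancel₀ hj.ne'
  rw [h3]
  ring

lemma cumExpect_armGain_zero (M : (l : Fin B) → BanditAlg (Arm K (D l).m))
    (S : Auctioneer K D b) (T : ℕ) (l : Fin B) (i : Fin (D l).m) :
    cumExpect M S (armGain M S l i (Sum.inl 0)) T [] =
      -((D l).prob i * T * (timeAveraged M S T).interimUtility l i i) := by
  rcases Nat.eq_zero_or_pos T with rfl | hT
  · simp [cumExpect]
  have hT' : (T : ℝ) ≠ 0 := by positivity
  have h2 := prob_mul_interimUtility_timeAveraged M S T l i i
  rw [eq_div_iff hT'] at h2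
  -- The zero option never wins, and the bound on prices by allocation times bid then forces a zero
  -- price.
  have h0 : ∀ h β, armUtility M S h l i (Sum.inl 0) β = 0 := fun h β => by
    have ha : (S h).alloc (Function.update β l 0) l = 0 := (S h).alloc_zero _ _ (by simp)
    have hp : (S h).price (Function.update β l 0) l = 0 :=
      le_antisymm (((S h).price_le _ l).trans (by simp [ha])) ((S h).price_nonneg _ l)
    simp [armUtility, resolve_inl, optionUtility, ha, hp]
  rw [mul_right_comm, h2, ← neg_one_mul, ← cumExpect_const_mul]
  congr 1
  funext h r
  simp [armGain, h0]

lemma timeAveraged_isBIC (hM : ∀ l, (M l).HasFullSupport)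
    (hb : ∀ k, b k ∈ Set.Icc (0 : ℝ) 1) {T : ℕ} {δ : ℝ} (hδ : ∀ l, (M l).IsNoRegret T δ)
    (S : Auctioneer K D b) : (timeAveraged M S T).IsBIC (δ / (qMin D * T)) := by
  intro l i j
  -- For `T = 0`, division by zero makes both the mechanism and the error vanish.
  rcases Nat.eq_zero_or_pos T with rfl | hT
  · simp [DirectMechanism.interimUtility, timeAveraged]
  have hT' : (0 : ℝ) < T := by positivity
  have hq := qMin_pos D l
  have h1 := cumExpect_armGain_le hM hb (hδ l) S i (Sum.inr j)
  rw [cumExpect_armGain_inr hM, mul_comm, ← le_div_iff₀ (mul_pos ((D l).prob_pos i) hT')] at h1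
  -- Passing to the smaller denominator needs `0 ≤ δ`.
  have h2 : δ / ((D l).prob i * T) ≤ δ / (qMin D * T) :=
    div_le_div_of_nonneg_left (hδ l).nonneg (mul_pos hq hT')
      (mul_le_mul_of_nonneg_right (qMin_le D l i) hT'.le)
  linarith

lemma timeAveraged_isInterimIR (hM : ∀ l, (M l).HasFullSupport)
    (hb : ∀ k, b k ∈ Set.Icc (0 : ℝ) 1) {T : ℕ} {δ : ℝ} (hδ : ∀ l, (M l).IsNoRegret T δ)
    (S : Auctioneer K D b) : (timeAveraged M S T).IsInterimIR (δ / (qMin D * T)) := by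
  intro l i
  rcases Nat.eq_zero_or_pos T with rfl | hT
  · simp [DirectMechanism.interimUtility, timeAveraged]
  have hT' : (0 : ℝ) < T := by positivity
  have hq := qMin_pos D l
  have h1 := cumExpect_armGain_le hM hb (hδ l) S i (Sum.inl 0)
  rw [cumExpect_armGain_zero, ← mul_neg, mul_comm,
    ← le_div_iff₀ (mul_pos ((D l).prob_pos i) hT')] at h1
  have h2 : δ / ((D l).prob i * T) ≤ δ / (qMin D * T) :=
    div_le_div_of_nonneg_left (hδ l).nonneg (mul_pos hq hT')
      (mul_le_mul_of_nonneg_right (qMin_le D l i) hT'.le)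
  linarith

end TimeAveraged

end NoRegretAuction

namespace NoRegretAuction

/-! ### Assortative resampling -/

section Coupling

variable {m : ℕ}

/-- A coupling of `q` with itself that maximizes the expectation of `v i * x j` is assortative. -/
lemma exists_assortative_coupling {q v : Fin m → ℝ} (hq : ∀ i, 0 ≤ q i) (hv : StrictMono v)
    (x : Fin m → ℝ) : ∃ γ : Fin m → Fin m → ℝ, (∀ i j, 0 ≤ γ i j) ∧ (∀ i, ∑ j, γ i j = q i) ∧
      (∀ j, ∑ i, γ i j = q j) ∧ ∑ i, q i * (v i * x i) ≤ ∑ i, ∑ j, γ i j * (v i * x j) ∧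
      ∀ i i' j j', i < i' → 0 < γ i j → 0 < γ i' j' → x j ≤ x j' := by
  set C : Set (Fin m → Fin m → ℝ) :=
    {γ | (∀ i j, 0 ≤ γ i j) ∧ (∀ i, ∑ j, γ i j = q i) ∧ ∀ j, ∑ i, γ i j = q j} with hC
  set f : (Fin m → Fin m → ℝ) → ℝ := fun γ => ∑ i, ∑ j, γ i j * (v i * x j) with hf
  have hclosed : IsClosed C := by
    simp only [hC, Set.ofPred_and, Set.ofPred_forall]
    refine (isClosed_iInter fun i => isClosed_iInter fun j => isClosed_le ?_ ?_).inter
      ((isClosed_iInter fun i => isClosed_eq ?_ ?_).inter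
        (isClosed_iInter fun j => isClosed_eq ?_ ?_)) <;> fun_prop
  have hcompact : IsCompact C := by
    refine (isCompact_Icc (a := (0 : Fin m → Fin m → ℝ)) (b := fun i _ => q i)).of_isClosed_subset
      hclosed fun γ hγ => ⟨fun i j => hγ.1 i j, fun i j => ?_⟩
    change γ i j ≤ q i
    rw [← hγ.2.1 i]
    exact Finset.single_le_sum (fun j _ => hγ.1 i j) (Finset.mem_univ j)
  -- The identity coupling shows that `C` is nonempty and supplies the value that the maximizer must
  -- reach.
  have hdiag : (fun i j => if i = j then q i else 0) ∈ C :=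
    ⟨fun i j => by dsimp only; split_ifs <;> simp [hq], fun i => by simp, fun j => by simp⟩
  obtain ⟨γ, hγ, hmax⟩ := hcompact.exists_isMaxOn ⟨_, hdiag⟩
    (f := f) (by fun_prop)
  refine ⟨γ, hγ.1, hγ.2.1, hγ.2.2, ?_, ?_⟩
  · have := hmax hdiag
    simpa [hf] using this
  · intro i i' j j' hi hij hij'
    by_contra! hlt
    have hjj : j ≠ j' := by rintro rfl; exact lt_irrefl _ hlt
    set t := min (γ i j) (γ i' j') with ht
    have ht0 : 0 < t := lt_min hij hij'
    -- Exchange argument: the perturbation `t * a c * e d` moves mass `t` from `(i, j)` and `(i',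
    -- j')` to `(i, j')` and `(i', j)`. It keeps the marginals and would raise the objective.
    set a : Fin m → ℝ := fun c => (if c = i' then 1 else 0) - if c = i then 1 else 0 with ha
    set e : Fin m → ℝ := fun c => (if c = j then 1 else 0) - if c = j' then 1 else 0 with he
    have hmem : (fun c d => γ c d + t * a c * e d) ∈ C := by
      refine ⟨fun c d => ?_, fun c => ?_, fun d => ?_⟩
      · have h1 := hγ.1 c d
        have h2 : t ≤ γ i j := min_le_left _ _
        have h3 : t ≤ γ i' j' := min_le_right _ _
        dsimp only
        rcases eq_or_ne c i with hci | hci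
        · have hac : a c = -1 := by simp [ha, hci, hi.ne]
          rcases eq_or_ne d j with hdj | hdj
          · have hed : e d = 1 := by simp [he, hdj, hjj]
            rw [hac, hed, hci, hdj]
            linarith
          · have hed : e d ≤ 0 := by
              simp only [he, if_neg hdj]
              split_ifs <;> norm_num
            rw [hac]
            nlinarith
        · rcases eq_or_ne c i' with hci' | hci'
          · have hac : a c = 1 := by simp [ha, hci', hi.ne']
            rcases eq_or_ne d j' with hdj | hdj
            · have hed : e d = -1 := by simp [he, hdj, hjj.symm]
              rw [hac, hed, hci', hdj]
              linarith
            · have hed : 0 ≤ e d := by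
                simp only [he, if_neg hdj]
                split_ifs <;> norm_num
              rw [hac]
              nlinarith
          · have hac : a c = 0 := by simp [ha, hci, hci']
            rw [hac]
            linarith
      · simp only [Finset.sum_add_distrib, ← Finset.mul_sum, hγ.2.1]
        simp [he]
      · simp only [Finset.sum_add_distrib, ← Finset.sum_mul, ← Finset.mul_sum, hγ.2.2]
        simp [ha]
    have hle : f _ ≤ f γ := hmax hmem
    have hval : f (fun c d => γ c d + t * a c * e d) =
        f γ + t * ((∑ c, a c * v c) * ∑ d, e d * x d) := by
      simp only [hf, add_mul, Finset.sum_add_distrib, Finset.sum_mul, Finset.mul_sum]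
      congr 1
      rw [Finset.sum_comm]
      exact Finset.sum_congr rfl fun c _ => Finset.sum_congr rfl fun d _ => by ring
    have hsa : ∑ c, a c * v c = v i' - v i := by simp [ha, sub_mul]
    have hse : ∑ d, e d * x d = x j - x j' := by simp [he, sub_mul]
    rw [hval, hsa, hse] at hle
    have := mul_pos ht0 (mul_pos (sub_pos.2 (hv hi)) (sub_pos.2 hlt))
    linarith

/-- If row `k` reached a column `j0` with `x j0 > s`, then `j0 > k`, and assortativity would push
all mass of the rows above `k` into columns above `k`. Those columns are then already full, leaving
no room for the mass at `(k, j0)`. -/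
lemma assortative_mean_le {q : Fin m → ℝ} {x : Fin m → ℝ} {γ : Fin m → Fin m → ℝ}
    (hγ : ∀ i j, 0 ≤ γ i j) (hrow : ∀ i, ∑ j, γ i j = q i) (hcol : ∀ j, ∑ i, γ i j = q j)
    (hass : ∀ i i' j j', i < i' → 0 < γ i j → 0 < γ i' j' → x j ≤ x j') (k : Fin m) {s : ℝ}
    (hs : ∀ j ≤ k, x j ≤ s) : ∑ j, γ k j * x j ≤ q k * s := by
  rw [← hrow k, Finset.sum_mul]
  refine Finset.sum_le_sum fun j0 _ => ?_
  by_contra! hlt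
  have hpos : 0 < γ k j0 := (hγ k j0).lt_of_ne fun h => by simp [← h] at hlt
  have hx : s < x j0 := lt_of_mul_lt_mul_left hlt (hγ k j0)
  have hk : k < j0 := by
    by_contra! h
    exact absurd (hs j0 h) (not_le.2 hx)
  have h1 : ∀ i ∈ Finset.Ioi k, ∑ j ∈ Finset.Ioi k, γ i j = q i := fun i hi => by
    rw [← hrow i]
    refine Finset.sum_subset (Finset.subset_univ _) fun j _ hj => ?_
    by_contra hne
    have h2 := hass k i j0 j (Finset.mem_Ioi.1 hi) hpos ((hγ i j).lt_of_ne (Ne.symm hne))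
    exact absurd (hs j (not_lt.1 fun h => hj (Finset.mem_Ioi.2 h))) (not_le.2 (hx.trans_le h2))
  have h2 : ∑ j ∈ Finset.Ioi k, q j = ∑ i, ∑ j ∈ Finset.Ioi k, γ i j := by
    rw [Finset.sum_comm]
    exact Finset.sum_congr rfl fun j _ => (hcol j).symm
  have h3 : ∑ i ∈ insert k (Finset.Ioi k), ∑ j ∈ Finset.Ioi k, γ i j ≤
      ∑ i, ∑ j ∈ Finset.Ioi k, γ i j :=
    Finset.sum_le_sum_of_subset_of_nonneg (Finset.subset_univ _)
      fun i _ _ => Finset.sum_nonneg fun j _ => hγ i j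
  rw [Finset.sum_insert (by simp), ← h2, Finset.sum_congr rfl h1] at h3
  have h4 := Finset.single_le_sum (f := fun j => γ k j) (fun j _ => hγ k j) (Finset.mem_Ioi.2 hk)
  linarith

end Coupling

/-! ### Payments for monotone allocations -/

section Payments

/-- Information rent: the utility of the value `V n` under the least payments that make the
allocation `Y` incentive compatible. -/
noncomputable def rent (V Y : ℕ → ℝ) (n : ℕ) : ℝ :=
  ∑ k ∈ Finset.range n, (V (k + 1) - V k) * Y k

lemma rent_succ (V Y : ℕ → ℝ) (n : ℕ) : rent V Y (n + 1) = rent V Y n + (V (n + 1) - V n) * Y n :=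
  Finset.sum_range_succ _ _

lemma rent_lower {V Y : ℕ → ℝ} (hV : Monotone V) (hY : Monotone Y) {a n : ℕ} (h : a ≤ n) :
    rent V Y a + (V n - V a) * Y a ≤ rent V Y n := by
  induction n, h using Nat.le_induction with
  | base => simp
  | succ n h ih =>
    rw [rent_succ]
    nlinarith [mul_le_mul_of_nonneg_left (hY h) (sub_nonneg.2 (hV n.le_succ))]

lemma rent_upper {V Y : ℕ → ℝ} (hV : Monotone V) (hY : Monotone Y) {a n : ℕ} (h : a ≤ n) :
    rent V Y n ≤ rent V Y a + (V n - V a) * Y n := by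
  induction n, h using Nat.le_induction with
  | base => simp
  | succ n h ih =>
    rw [rent_succ]
    nlinarith [mul_le_mul_of_nonneg_left (hY n.le_succ) (sub_nonneg.2 (hV n.le_succ)),
      mul_le_mul_of_nonneg_left (hY n.le_succ) (sub_nonneg.2 (hV h))]

lemma rent_nonneg {V Y : ℕ → ℝ} (hV : Monotone V) (hY : ∀ n, 0 ≤ Y n) (n : ℕ) :
    0 ≤ rent V Y n :=
  Finset.sum_nonneg fun k _ => mul_nonneg (sub_nonneg.2 (hV k.le_succ)) (hY k)

lemma rent_mono_right {V Y Z : ℕ → ℝ} (hV : Monotone V) (hYZ : ∀ n, Y n ≤ Z n) (n : ℕ) :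
    rent V Y n ≤ rent V Z n :=
  Finset.sum_le_sum fun k _ => mul_le_mul_of_nonneg_left (hYZ k) (sub_nonneg.2 (hV k.le_succ))

/-- For a monotone allocation, utilities equal to the rents satisfy every incentive constraint, in
both directions. -/
lemma rent_incentive {V Y : ℕ → ℝ} (hV : Monotone V) (hY : Monotone Y) (i j : ℕ) :
    rent V Y j + (V i - V j) * Y j ≤ rent V Y i := by
  rcases le_total j i with h | h
  · exact rent_lower hV hY h
  · linarith [rent_upper hV hY h]

/-- Approximate incentive compatibility forces almost the full information rent, even of the
monotone envelope of the allocation, independently of the number of values. -/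
lemma rent_partialSups_le {V X u : ℕ → ℝ} (hV : Monotone V) (hV0 : ∀ n, 0 ≤ V n)
    (hX : ∀ n, 0 ≤ X n) {ε η : ℝ} (hε : 0 ≤ ε) (hη : 0 < η) (hIR : -ε ≤ u 0)
    (hIC : ∀ i j, u j + (V i - V j) * X j ≤ u i + ε) (n : ℕ) :
    rent V (partialSups X) n ≤ u n + η * partialSups X n + 4 * ε / η * V n + 3 * ε := by
  have hS : Monotone (partialSups X) := (partialSups X).monotone
  have hS0 : ∀ n, 0 ≤ partialSups X n := fun n => (hX n).trans (le_partialSups X n)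
  -- Let `j ≤ a` attain the running maximum. The constraints that `b` not report `j` and `j` not
  -- report `a` add up to this bound, since `X a ≤ X j`.
  have step : ∀ a b, a ≤ b → u a + (V b - V a) * partialSups X a ≤ u b + 2 * ε := by
    intro a b hab
    obtain ⟨j, hj, hSj⟩ := exists_partialSups_eq X a
    rw [hSj]
    have h1 := hIC b j
    have h2 := hIC j a
    have h3 : X a ≤ X j := hSj ▸ le_partialSups X a
    nlinarith [mul_le_mul_of_nonneg_left h3 (sub_nonneg.2 (hV hj))]
  have hcoef : 0 ≤ 4 * ε / η := by positivity
  induction n using Nat.strong_induction_on with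
  | _ n ih =>
    have hex : ∃ c, V n - η ≤ V c := ⟨n, by linarith⟩
    classical
    -- All values within `η` below `V n` are crossed in one jump. Together with the step entering
    -- this block it costs `4 * ε`, but the value has then dropped by more than `η`, so these costs
    -- add up to at most `4 * ε / η * V n`. The rent error inside a block is at most `η` times the
    -- increase of the running maximum, and this telescopes.
    obtain ⟨c, hc, hcmin⟩ : ∃ c, V n - η ≤ V c ∧ ∀ c' < c, V c' < V n - η :=
      ⟨Nat.find hex, Nat.find_spec hex, fun c' h => not_le.1 (Nat.find_min hex h)⟩
    have hcn : c ≤ n := by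
      by_contra! h
      linarith [hcmin n h]
    have h1 := step c n hcn
    have h2 := rent_upper hV hS hcn
    have h3 : (V n - V c) * (partialSups X n - partialSups X c) ≤
        η * (partialSups X n - partialSups X c) :=
      mul_le_mul_of_nonneg_right (by linarith) (sub_nonneg.2 (hS hcn))
    -- If the block reaches index `0`, the bound `-ε ≤ u 0` and a single jump cost `3 * ε`.
    rcases c with _ | c
    · have h4 : rent V (partialSups X) 0 = 0 := by simp [rent]
      have h5 := mul_nonneg hcoef (hV0 n)
      have h6 := mul_nonneg hη.le (hS0 0)
      nlinarith
    · have h4 := ih c (by omega)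
      have h5 := step c (c + 1) c.le_succ
      have h6 := rent_succ V (partialSups X) c
      have h7 := mul_le_mul_of_nonneg_left (hS c.le_succ) hη.le
      have h8 : 4 * ε ≤ 4 * ε / η * (V n - V c) := by
        calc 4 * ε = 4 * ε / η * η := by field_simp
          _ ≤ _ := mul_le_mul_of_nonneg_left (by linarith [hcmin c c.lt_succ_self]) hcoef
      nlinarith

end Payments

/-! ### From approximate to exact incentive compatibility -/

/-- For a single bidder with interim allocation `x` and utilities `u`: reports can be resampled,
without changing their distribution, and charged so that truthfulness becomes exactly optimal,
at a small loss in payments. -/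
lemma exists_exact_resampling (d : ValueDist) {x u : Fin d.m → ℝ} (hx0 : ∀ i, 0 ≤ x i)
    (hx1 : ∀ i, x i ≤ 1) {ε η : ℝ} (hε : 0 ≤ ε) (hη : 0 < η) (hIR : ∀ i, -ε ≤ u i)
    (hIC : ∀ i j, u j + (d.val i - d.val j) * x j ≤ u i + ε) :
    ∃ (κ : Fin d.m → Fin d.m → ℝ) (P : Fin d.m → ℝ), (∀ i j, 0 ≤ κ i j) ∧
      (∀ i, ∑ j, κ i j = 1) ∧ (∀ j, ∑ i, d.prob i * κ i j = d.prob j) ∧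
      (∀ i j, d.val i * (∑ k, κ j k * x k) - P j ≤ d.val i * (∑ k, κ i k * x k) - P i) ∧
      (∀ i, 0 ≤ d.val i * (∑ k, κ i k * x k) - P i) ∧
      ∑ i, d.prob i * (d.val i * x i - u i) ≤
        ∑ i, d.prob i * P i + (η + 4 * ε / η + 3 * ε) := by
  obtain ⟨γ, hγ, hrow, hcol, hopt, hass⟩ :=
    exists_assortative_coupling (fun i => (d.prob_pos i).le) d.val_strictMono x
  have hq := d.prob_pos
  set κ : Fin d.m → Fin d.m → ℝ := fun i j => γ i j / d.prob i with hκ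
  have hγκ : ∀ i j, γ i j = d.prob i * κ i j := fun i j => (mul_div_cancel₀ _ (hq i).ne').symm
  have hκ0 : ∀ i j, 0 ≤ κ i j := fun i j => div_nonneg (hγ i j) (hq i).le
  have hκ1 : ∀ i, ∑ j, κ i j = 1 := fun i => by
    rw [hκ, ← Finset.sum_div, hrow, div_self (hq i).ne']
  set y : Fin d.m → ℝ := fun i => ∑ k, κ i k * x k with hy
  have hy0 : ∀ i, 0 ≤ y i := fun i => Finset.sum_nonneg fun k _ => mul_nonneg (hκ0 i k) (hx0 k)
  have hymono : Monotone y := by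
    intro i i' hii
    rcases hii.eq_or_lt with rfl | hlt
    · exact le_rfl
    -- Independent draws from rows `i < i'` are compared; assortativity orders them pointwise on the
    -- supports.
    calc y i = ∑ j, κ i j * ∑ j', κ i' j' * x j :=
          Finset.sum_congr rfl fun j _ => by rw [weighted_sum_const _ (hκ1 i')]
      _ ≤ ∑ j, κ i j * ∑ j', κ i' j' * x j' := by
          simp only [Finset.mul_sum]
          refine Finset.sum_le_sum fun j _ => Finset.sum_le_sum fun j' _ => ?_
          rcases (hκ0 i j).eq_or_lt with h | h
          · simp [← h]
          rcases (hκ0 i' j').eq_or_lt with h' | h'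
          · simp [← h']
          refine mul_le_mul_of_nonneg_left (mul_le_mul_of_nonneg_left ?_ h'.le) h.le
          refine hass i i' j j' hlt ?_ ?_
          · rw [hγκ]; exact mul_pos (hq i) h
          · rw [hγκ]; exact mul_pos (hq i') h'
      _ = y i' := weighted_sum_const _ (hκ1 i) _
  obtain ⟨i0⟩ := d.nonempty
  have hm : 0 < d.m := i0.pos
  -- Indices are clamped at the last value, so the sequences on `ℕ` used for rents are constant
  -- beyond it.
  set c : ℕ → Fin d.m := fun n => ⟨min n (d.m - 1), by omega⟩ with hc
  have hcmono : Monotone c := fun a b hab => Fin.mk_le_mk.2 (min_le_min_right _ hab)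
  have hcval : ∀ i : Fin d.m, c i = i := fun i => Fin.ext (min_eq_left (by omega))
  have hcle : ∀ n, (c n : ℕ) ≤ n := fun n => min_le_left _ _
  set V : ℕ → ℝ := d.val ∘ c with hV
  have hVmono : Monotone V := d.val_strictMono.monotone.comp hcmono
  have hYmono : Monotone (y ∘ c) := hymono.comp hcmono
  have hyS : ∀ n, (y ∘ c) n ≤ partialSups (x ∘ c) n := by
    intro n
    have h1 := assortative_mean_le hγ hrow hcol hass (c n) (s := partialSups (x ∘ c) n)
      fun j hj => by
        have := le_partialSups_of_le (x ∘ c) ((Fin.val_le_of_le hj).trans (hcle n))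
        simpa [hcval] using this
    simp only [hγκ, mul_assoc, ← Finset.mul_sum] at h1
    exact le_of_mul_le_mul_left h1 (hq _)
  have hS1 : ∀ n, partialSups (x ∘ c) n ≤ 1 := fun n =>
    partialSups_le _ _ _ fun k _ => hx1 _
  have hrent : ∀ i : Fin d.m, rent V (y ∘ c) i ≤ u i + (η + 4 * ε / η + 3 * ε) := by
    intro i
    have h1 := rent_partialSups_le hVmono (fun n => d.val_nonneg _) (X := x ∘ c) (u := u ∘ c)
      (fun n => hx0 _) hε hη (hIR _) (fun a b => hIC (c a) (c b)) i
    have h2 := rent_mono_right hVmono hyS i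
    have h3 : η * partialSups (x ∘ c) i ≤ η * 1 := mul_le_mul_of_nonneg_left (hS1 i) hη.le
    have h4 : 4 * ε / η * V i ≤ 4 * ε / η * 1 :=
      mul_le_mul_of_nonneg_left (d.val_le_one _) (by positivity)
    simp only [Function.comp_apply, hcval] at h1
    linarith
  -- These payments leave each value exactly its rent as utility. Revenue is welfare minus utility:
  -- welfare does not fall, by optimality of the coupling, and utility rises by at most the stated
  -- loss.
  refine ⟨κ, fun i => d.val i * y i - rent V (y ∘ c) i, hκ0, hκ1, ?_, ?_, ?_, ?_⟩
  · intro j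
    simp only [← hγκ, hcol]
  · intro i j
    have := rent_incentive hVmono hYmono i j
    simp only [hV, Function.comp_apply, hcval] at this
    have h2 : ∑ k, κ j k * x k = y j := rfl
    have h3 : ∑ k, κ i k * x k = y i := rfl
    rw [h2, h3]
    simp only [hV]
    linarith
  · intro i
    have := rent_nonneg hVmono (Y := y ∘ c) (fun n => hy0 _) i
    have h3 : ∑ k, κ i k * x k = y i := rfl
    rw [h3]
    linarith
  · have h1 : ∑ i, ∑ j, γ i j * (d.val i * x j) = ∑ i, d.prob i * (d.val i * y i) := by
      refine Finset.sum_congr rfl fun i _ => ?_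
      simp only [hγκ, hy, Finset.mul_sum]
      exact Finset.sum_congr rfl fun j _ => by ring
    rw [h1] at hopt
    have h2 : ∑ i, d.prob i * rent V (y ∘ c) i ≤
        ∑ i, d.prob i * u i + (η + 4 * ε / η + 3 * ε) := by
      rw [← weighted_sum_const _ d.prob_sum (η + 4 * ε / η + 3 * ε), ← Finset.sum_add_distrib]
      refine Finset.sum_le_sum fun i _ => ?_
      rw [← mul_add]
      exact mul_le_mul_of_nonneg_left (hrent i) (hq i).le
    simp only [mul_sub, Finset.sum_sub_distrib]
    linarith

/-! ### Interim quantities, resampled mechanisms and comparison with the optimum. -/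

namespace DirectMechanism

variable {B : ℕ} {D : Fin B → ValueDist}

/-- Expected winning probability of bidder `l` when reporting the value of index `j`. -/
noncomputable def interimAlloc (X : DirectMechanism D) (l : Fin B) (j : Fin (D l).m) : ℝ :=
  ∑ w, profileProb D w * X.alloc (Function.update w l j) l

/-- Expected payment of bidder `l` when reporting the value of index `j`. -/
noncomputable def interimPay (X : DirectMechanism D) (l : Fin B) (j : Fin (D l).m) : ℝ :=
  ∑ w, profileProb D w * X.pay (Function.update w l j) l

lemma interimUtility_eq (X : DirectMechanism D) (l : Fin B) (i j : Fin (D l).m) :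
    X.interimUtility l i j = (D l).val i * X.interimAlloc l j - X.interimPay l j := by
  simp only [interimUtility, interimAlloc, interimPay, mul_sub, Finset.sum_sub_distrib,
    Finset.mul_sum, mul_left_comm]

lemma revenue_eq (X : DirectMechanism D) :
    X.revenue = ∑ l, ∑ j, (D l).prob j * X.interimPay l j := by
  simp only [revenue, Finset.mul_sum]
  rw [Finset.sum_comm]
  refine Finset.sum_congr rfl fun l _ => ?_
  rw [sum_profileProb_resample D l]
  simp only [interimPay, Finset.mul_sum]

lemma IsFeasible.alloc_le_one {X : DirectMechanism D} (hX : X.IsFeasible) (w : Profile D)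
    (l : Fin B) : X.alloc w l ≤ 1 :=
  (Finset.single_le_sum (fun l _ => hX.1 w l) (Finset.mem_univ l)).trans (hX.2 w)

lemma IsFeasible.interimAlloc_nonneg {X : DirectMechanism D} (hX : X.IsFeasible) (l : Fin B)
    (j : Fin (D l).m) : 0 ≤ X.interimAlloc l j :=
  Finset.sum_nonneg fun w _ => mul_nonneg (profileProb_pos D w).le (hX.1 _ _)

lemma IsFeasible.interimAlloc_le_one {X : DirectMechanism D} (hX : X.IsFeasible) (l : Fin B)
    (j : Fin (D l).m) : X.interimAlloc l j ≤ 1 := by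
  rw [← weighted_sum_const _ (sum_profileProb D) 1]
  exact Finset.sum_le_sum fun w _ =>
    mul_le_mul_of_nonneg_left (hX.alloc_le_one _ _) (profileProb_pos D w).le

/-- A crude bound that makes the set in `mye` bounded above, so that its supremum is meaningful. -/
lemma IsFeasible.revenue_le {X : DirectMechanism D} (hX : X.IsFeasible)
    (hIR : X.IsInterimIR 0) : X.revenue ≤ B := by
  rw [revenue_eq]
  calc _ ≤ ∑ l : Fin B, ∑ j, (D l).prob j * 1 := by
        refine Finset.sum_le_sum fun l _ => Finset.sum_le_sum fun j _ =>
          mul_le_mul_of_nonneg_left ?_ ((D l).prob_pos j).le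
        have h1 := hIR l j
        rw [interimUtility_eq] at h1
        have h2 := mul_le_mul_of_nonneg_right ((D l).val_le_one j) (hX.interimAlloc_nonneg l j)
        linarith [hX.interimAlloc_le_one l j]
    _ = B := by simp [(D _).prob_sum]

lemma revenue_le_mye {X : DirectMechanism D} (hX : X.IsFeasible) (hIC : X.IsBIC 0)
    (hIR : X.IsInterimIR 0) : X.revenue ≤ mye D := by
  refine le_csSup ⟨B, ?_⟩ ⟨X, hX, hIC, hIR, rfl⟩
  rintro _ ⟨Y, hY, -, hYIR, rfl⟩
  exact hY.revenue_le hYIR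

/-- Every bidder's report is resampled by the kernel `κ l`, and the payment is a function of the
own report only. -/
noncomputable def resampled (X : DirectMechanism D)
    (κ : (l : Fin B) → Fin (D l).m → Fin (D l).m → ℝ) (P : (l : Fin B) → Fin (D l).m → ℝ) :
    DirectMechanism D where
  alloc w l := ∑ w' : Profile D, (∏ l', κ l' (w l') (w' l')) * X.alloc w' l
  pay w l := P l (w l)

section Resampled

variable {X : DirectMechanism D} {κ : (l : Fin B) → Fin (D l).m → Fin (D l).m → ℝ}
  {P : (l : Fin B) → Fin (D l).m → ℝ}

lemma resampled_isFeasible (hX : X.IsFeasible) (hκ : ∀ l i j, 0 ≤ κ l i j)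
    (hκ1 : ∀ l i, ∑ j, κ l i j = 1) (P : (l : Fin B) → Fin (D l).m → ℝ) :
    (X.resampled κ P).IsFeasible := by
  have h0 : ∀ w w' : Profile D, 0 ≤ ∏ l', κ l' (w l') (w' l') :=
    fun w w' => Finset.prod_nonneg fun l _ => hκ _ _ _
  refine ⟨fun w l => Finset.sum_nonneg fun w' _ => mul_nonneg (h0 w w') (hX.1 w' l), fun w => ?_⟩
  simp only [resampled]
  rw [Finset.sum_comm]
  simp only [← Finset.mul_sum]
  calc _ ≤ ∑ w' : Profile D, (∏ l', κ l' (w l') (w' l')) * 1 :=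
        Finset.sum_le_sum fun w' _ => mul_le_mul_of_nonneg_left (hX.2 w') (h0 w w')
    _ = 1 := by
        simp only [mul_one]
        exact FiniteProduct.sum_prod_eq_one (fun l => κ l (w l)) fun l => hκ1 l (w l)

/-- When the kernels preserve the value distributions, the reports of the other bidders are
distributed as before, and only the own kernel affects the interim allocation. -/
lemma resampled_interimAlloc (hq : ∀ l j, ∑ i, (D l).prob i * κ l i j = (D l).prob j)
    (l : Fin B) (j : Fin (D l).m) :
    (X.resampled κ P).interimAlloc l j = ∑ k, κ l j k * X.interimAlloc l k := by
  have hpos := fun l => (D l).prob_pos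
  have bayes : ∀ w' : Profile D, ∑ w, profileProb D w *
      ((if w l = j then 1 else 0) * ∏ l', κ l' (w l') (w' l')) =
      profileProb D w' * ((D l).prob j * κ l j (w' l) / (D l).prob (w' l)) := by
    intro w'
    -- Posterior of the true value given the resampled report `w' l`; it has total mass one because
    -- the kernel preserves the value distribution.
    set p : (l : Fin B) → Fin (D l).m → ℝ :=
      fun l i => (D l).prob i * κ l i (w' l) / (D l).prob (w' l) with hp
    have hp1 : ∀ l, ∑ i, p l i = 1 := fun l => by
      simp only [hp]
      rw [← Finset.sum_div, hq, div_self (hpos l _).ne']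
    have h1 : ∀ w : Profile D, profileProb D w *
        ((if w l = j then 1 else 0) * ∏ l', κ l' (w l') (w' l')) =
        profileProb D w' * ((∏ l', p l' (w l')) * if w l = j then 1 else 0) := fun w => by
      have h2 : profileProb D w * ∏ l', κ l' (w l') (w' l') =
          profileProb D w' * ∏ l', p l' (w l') := by
        simp only [profileProb, ← Finset.prod_mul_distrib]
        exact Finset.prod_congr rfl fun l' _ => (mul_div_cancel₀ _ (hpos l' _).ne').symm
      rw [mul_left_comm, h2]
      ring
    simp only [h1]
    rw [← Finset.mul_sum, FiniteProduct.sum_resample p l (hp1 l) fun w => if w l = j then 1 else 0]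
    simp only [Function.update_self]
    rw [weighted_sum_const _ (FiniteProduct.sum_prod_eq_one p hp1)]
    simp [hp]
  apply mul_left_cancel₀ (hpos l j).ne'
  rw [interimAlloc, prob_mul_sum_update D l j fun w => (X.resampled κ P).alloc w l]
  calc _ = ∑ w' : Profile D, (∑ w, profileProb D w *
        ((if w l = j then 1 else 0) * ∏ l', κ l' (w l') (w' l'))) * X.alloc w' l := by
        simp only [resampled, Finset.mul_sum, Finset.sum_mul]
        rw [Finset.sum_comm]
        exact Finset.sum_congr rfl fun w' _ => Finset.sum_congr rfl fun w _ => by ring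
    _ = ∑ w' : Profile D, profileProb D w' *
        ((D l).prob j * κ l j (w' l) / (D l).prob (w' l) * X.alloc w' l) := by
        simp only [bayes, mul_assoc]
    _ = _ := by
        rw [sum_profileProb_resample D l, Finset.mul_sum]
        refine Finset.sum_congr rfl fun k _ => ?_
        simp only [Function.update_self, interimAlloc, Finset.mul_sum]
        refine Finset.sum_congr rfl fun w _ => ?_
        have := (hpos l k).ne'
        field_simp

lemma resampled_interimPay (l : Fin B) (j : Fin (D l).m) :
    (X.resampled κ P).interimPay l j = P l j := by
  simp only [interimPay, resampled, Function.update_self]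
  exact weighted_sum_const _ (sum_profileProb D) _

end Resampled

/-- All bidders are corrected simultaneously: each kernel changes only its own bidder's interim
allocation, so the single-bidder constructions do not interfere and their losses add. -/
lemma revenue_le_mye_add {X : DirectMechanism D} {ε η : ℝ} (hX : X.IsFeasible) (hIC : X.IsBIC ε)
    (hIR : X.IsInterimIR ε) (hε : 0 ≤ ε) (hη : 0 < η) :
    X.revenue ≤ mye D + B * (η + 4 * ε / η + 3 * ε) := by
  choose κ P hκ0 hκ1 hκq hPIC hPIR hP using fun l =>
    exists_exact_resampling (D l) (x := X.interimAlloc l) (u := fun i => X.interimUtility l i i)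
      (hX.interimAlloc_nonneg l) (hX.interimAlloc_le_one l) hε hη (hIR l) fun i j => by
        have := hIC l i j
        simp only [interimUtility_eq] at this ⊢
        linarith
  have h1 : (X.resampled κ P).revenue ≤ mye D := by
    refine revenue_le_mye (resampled_isFeasible hX hκ0 hκ1 P) (fun l i j => ?_) fun l i => ?_
    · simp only [interimUtility_eq, resampled_interimAlloc hκq, resampled_interimPay, add_zero]
      exact hPIC l i j
    · simp only [interimUtility_eq, resampled_interimAlloc hκq, resampled_interimPay, neg_zero]
      exact hPIR l i
  have h2 : X.revenue ≤ (X.resampled κ P).revenue + B * (η + 4 * ε / η + 3 * ε) := by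
    simp only [revenue_eq, resampled_interimPay]
    have h3 : (B : ℝ) * (η + 4 * ε / η + 3 * ε) = ∑ _l : Fin B, (η + 4 * ε / η + 3 * ε) := by
      rw [Finset.sum_const, Finset.card_univ, Fintype.card_fin, nsmul_eq_mul]
    rw [h3, ← Finset.sum_add_distrib]
    refine Finset.sum_le_sum fun l _ => le_trans (le_of_eq ?_) (hP l)
    refine Finset.sum_congr rfl fun i _ => ?_
    rw [interimUtility_eq]
    ring
  linarith

/-- The revenue of an approximately incentive compatible mechanism exceeds the optimal revenue by
at most the order of the square root of the approximation. -/
lemma revenue_le_mye_add_sqrt {X : DirectMechanism D} {ε : ℝ} (hX : X.IsFeasible)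
    (hIC : X.IsBIC ε) (hIR : X.IsInterimIR ε) (hε : 0 ≤ ε) (hε1 : ε ≤ 1) :
    X.revenue ≤ mye D + 8 * B * √ε := by
  rcases hε.eq_or_lt with rfl | hpos
  · simpa using revenue_le_mye hX hIC hIR
  have hs : 0 < √ε := Real.sqrt_pos.2 hpos
  -- `η = √ε` balances `η` against `4 * ε / η`; since `ε ≤ 1`, the loss `5 * √ε + 3 * ε` is at most
  -- `8 * √ε`.
  have h1 := revenue_le_mye_add hX hIC hIR hε hs
  have h2 : 4 * ε / √ε = 4 * √ε := by rw [mul_div_assoc, Real.div_sqrt]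
  have h3 : ε ≤ √ε := Real.le_sqrt_of_sq_le (by nlinarith)
  rw [h2] at h1
  have h4 : (B : ℝ) * (√ε + 4 * √ε + 3 * ε) ≤ B * (8 * √ε) :=
    mul_le_mul_of_nonneg_left (by linarith) B.cast_nonneg
  linarith

lemma mye_nonneg (D : Fin B → ValueDist) : 0 ≤ mye D := by
  let Z : DirectMechanism D := ⟨fun _ _ => 0, fun _ _ => 0⟩
  have h : Z.revenue = 0 := by simp [Z, revenue]
  rw [← h]
  refine revenue_le_mye ⟨fun _ _ => le_rfl, fun _ => by simp [Z]⟩ (fun l i j => ?_) fun l i => ?_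
  · simp [Z, interimUtility]
  · simp [Z, interimUtility]

end DirectMechanism

/-! ### Assembling the revenue bound. -/

section Final

variable {B K : ℕ} {D : Fin B → ValueDist} {b : Fin (K + 1) → ℝ}
  {M : (l : Fin B) → BanditAlg (Arm K (D l).m)}

lemma timeAveraged_revenue_le_one (hM : ∀ l, (M l).HasFullSupport)
    (hb : ∀ k, b k ∈ Set.Icc (0 : ℝ) 1) (S : Auctioneer K D b) (T : ℕ) :
    (timeAveraged M S T).revenue ≤ 1 := by
  rw [← weighted_sum_const _ (sum_profileProb D) 1]
  refine Finset.sum_le_sum fun w _ => mul_le_mul_of_nonneg_left ?_ (profileProb_pos D w).le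
  exact (Finset.sum_le_sum fun l _ => timeAveraged_pay_le_alloc hM hb S T w l).trans
    ((timeAveraged_isFeasible hM S T).2 w)

lemma regret_ratio_nonneg {T : ℕ} {δ : ℝ} (hδ : ∀ l, (M l).IsNoRegret T δ) :
    0 ≤ δ / (qMin D * T) := by
  rcases isEmpty_or_nonempty (Fin B) with hB | ⟨⟨l⟩⟩
  -- Without bidders the infimum over the empty family is `0`, and the ratio is `0` by convention.
  · simp [qMin, Real.iInf_of_isEmpty]
  · exact div_nonneg (hδ l).nonneg (mul_nonneg (qMin_pos D l).le T.cast_nonneg)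

lemma mul_sqrt_regret_ratio (δ q : ℝ) (T : ℕ) : T * √(δ / (q * T)) = √(δ * T / q) := by
  rcases Nat.eq_zero_or_pos T with rfl | hT
  · simp
  have hT' : (0 : ℝ) < T := by positivity
  have h : δ * T / q = (T : ℝ) ^ 2 * (δ / (q * T)) := by
    rw [div_mul_eq_div_div]
    field_simp
  rw [h, Real.sqrt_mul (sq_nonneg _), Real.sqrt_sq hT'.le]

lemma expectedRevenue_le (hM : ∀ l, (M l).HasFullSupport)
    (hb : ∀ k, b k ∈ Set.Icc (0 : ℝ) 1) {T : ℕ} {δ : ℝ} (hδ : ∀ l, (M l).IsNoRegret T δ)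
    (S : Auctioneer K D b) :
    expectedRevenue M S T ≤ mye D * T + (8 * B + 1) * √(δ * T / qMin D) := by
  have hε := regret_ratio_nonneg hδ
  have key : (timeAveraged M S T).revenue ≤ mye D + (8 * B + 1) * √(δ / (qMin D * T)) := by
    have hs := Real.sqrt_nonneg (δ / (qMin D * T))
    rcases le_total (δ / (qMin D * T)) 1 with h1 | h1
    · have := DirectMechanism.revenue_le_mye_add_sqrt (timeAveraged_isFeasible hM S T)
        (timeAveraged_isBIC hM hb hδ S) (timeAveraged_isInterimIR hM hb hδ S) hε h1
      linarith
    -- When the error exceeds `1`, the trivial revenue bound `1` is at most its square root; this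
    -- accounts for the `+ 1` in the constant.
    · have h2 := timeAveraged_revenue_le_one hM hb S T
      have h3 := Real.one_le_sqrt.2 h1
      have h4 : 0 ≤ 8 * (B : ℝ) * √(δ / (qMin D * T)) := by positivity
      linarith [DirectMechanism.mye_nonneg D]
  rw [timeAveraged_revenue hM, ← mul_sqrt_regret_ratio]
  calc _ ≤ T * (mye D + (8 * B + 1) * √(δ / (qMin D * T))) :=
        mul_le_mul_of_nonneg_left key T.cast_nonneg
    _ = _ := by ring

end Final

end NoRegretAuction

theorem mainTheorem6 (B : ℕ) :
    ∃ C : ℝ, ∀ (K : ℕ) (b : Fin (K + 1) → ℝ),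
      b 0 = 0 → (∀ k, b k ∈ Set.Icc (0 : ℝ) 1) →
      ∀ (D : Fin B → ValueDist) (T : ℕ) (δ : ℝ)
        (M : (l : Fin B) → BanditAlg (Arm K (D l).m)),
        (∀ l, (M l).HasFullSupport) → (∀ l, (M l).IsNoRegret T δ) →
        ∀ S : Auctioneer K D b,
          expectedRevenue M S T ≤ mye D * T + C * Real.sqrt (δ * T / qMin D) ∧
          (timeAveraged M S T).IsFeasible ∧
          (timeAveraged M S T).IsBIC (δ / (qMin D * T)) ∧
          (timeAveraged M S T).IsInterimIR (δ / (qMin D * T)) := by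
  exact ⟨8 * B + 1, fun K b _ hb D T δ M hM hδ S => ⟨expectedRevenue_le hM hb hδ S,
    timeAveraged_isFeasible hM S T, timeAveraged_isBIC hM hb hδ S,
    timeAveraged_isInterimIR hM hb hδ S⟩⟩
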